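/- Let $p$ be a prime with $p\equiv 1 \pmod 3$, let $m\ge 1$ be an integer, and let $\theta,q\in\mathbb{Q}_p$ satisfy $$0<|q|_p^{\frac{m+1}{m}}\le|\theta-1|_p<|q|_p^{\frac{m+2}{m+1}}<1 .$$ Let $x^{(\infty)}=2-\theta-q$ and let $$f(x)=\left(\frac{\theta x+q-1}{x+\theta+q-2}\right)^3,\qquad f:\mathbb{Q}_p\setminus\{x^{(\infty)}\}\to\mathbb{Q}_p .$$ Iterates, preimages and images are those of this partially defined map. Write $\mathbb{B}_\rho(a)=\{x\in\mathbb{Q}_p:|x-a|_p<\rho\}$. The cubic $y^3-(1+\theta+\theta^2)y^2-(2\theta+1)(1-\theta-q)y-(1-\theta-q)^2$ has three roots $y^{(1)},y^{(2)},y^{(3)}\in\mathbb{Q}_p$ with $|y^{(1)}|_p=1>|1-\theta-q|_p=|y^{(2)}|_p=|y^{(3)}|_p$. For any such numbering, put $x^{(0)}=1$, $x^{(i)}=1-q+(\theta-1)(y^{(i)}-1)$ for $i=1,2,3$, and $r=|q|_p|\theta-1|_p$. Let $\mathcal D_1=\mathbb{B}_r(x^{(1)})$, let $\mathcal C_i=\{x: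 |x-x^{(i)}|_p<|x-x^{(\infty)}|_p=|q|_p|\theta-1|_p\}$ for $i=2,3$, and for $1\le l\le m$ let $\mathcal H_l$ be the union of all balls $\mathbb{B}_r(b)$ contained in the sphere $\mathcal G_l=\{x:|x-x^{(1)}|_p=|\theta-1|_p^{l+1}/|q|_p^{l}\}$ and such that $\mathcal C_2\cup\mathcal C_3\subset f^l(\mathbb{B}_r(b))$. Put $$X_m=\mathcal D_1\cup\mathcal H_m\cup\dots\cup\mathcal H_1\cup\mathcal C_2\cup\mathcal C_3,\qquad J_m=\bigcap_{n\ge0}f^{-n}(X_m).$$ Then the following hold. (i) $(X_m,J_m,f)$ is a transitive $p$-adic repeller: $X_m$ does not contain $x^{(\infty)}$, $f^{-1}(X_m)\subset X_m$, the sets $\mathcal D_1,\mathcal H_m,\dots,\mathcal H_1,\mathcal C_2,\mathcal C_3$ (in this order) are pairwise disjoint balls $\mathbb{B}_r(a_0),\dots,\mathbb{B}_r(a_{m+2})$, there are integers $\tau_0,\dots,\tau_{m+2}>0$ with $|f(x)-f(y)|_p=p^{\tau_j}|x-y|_p$ for all $x,y\in\mathbb{B}_r(a_j)$, and the incidence matrix,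 whose $(i,j)$ entry is $1$ if $f(\mathbb{B}_r(a_i))\cap\mathbb{B}_r(a_j)\ne\emptyset$ and $0$ otherwise, is irreducible. This incidence matrix is $$A_m=\begin{pmatrix}\mathbf e_1^T&\mathbf I_m&\mathbf 0^T&\mathbf 0^T\\0&\mathbf 0&1&1\\1&\mathbf 1&1&1\\1&\mathbf 1&1&1\end{pmatrix},$$ where $\mathbf I_m$ is the $m\times m$ identity matrix, $\mathbf e_1=(1,0,\dots,0)$, $\mathbf 1=(1,\dots,1)$ and $\mathbf 0=(0,\dots,0)$ are row vectors of length $m$, and $\mathbf{v}^T$ is the transpose of $\mathbf v$. The system $f:J_m\to J_m$ is isometrically conjugate to $(\Sigma_{A_m},\sigma,d_f)$, where $\Sigma_{A_m}$ is the one-sided subshift of finite type on $m+3$ symbols defined by $A_m$, $\sigma$ is the left shift, and, for $u\neq v$ in $\Sigma_{A_m}$ first differing at index $n$, $$d_f(u,v)=p^{-\tau_{u_0}-\dots-\tau_{u_{n-1}}}\,|a_{u_n}-a_{v_n}|_p$$ (with $d_f(u,u)=0$); $d_f$ induces the product topology on $\Sigma_{A_m}$. Moreover, $(\Sigma_{A_m},\sigma)$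 is topologically conjugate to the full shift on three symbols. (ii) One has $$\mathbb{Q}_p=\mathfrak B(x^{(0)})\cup J_m\cup\bigcup_{n\ge0}f^{-n}(\{x^{(\infty)}\}),$$ where $\mathfrak B(x^{(0)})$ is the set of points whose forward orbit is defined for all times and converges to $x^{(0)}$. -/

import Mathlib

open Filter Topology

noncomputable section

namespace PottsBethe

/-! ### Partially defined maps

A partially defined self-map of `α` is given by its domain `D` and a function `f : α → α` whose
values outside `D` are irrelevant: every notion below only follows orbits as long as they stay in
`D`. -/

section Partial

variable {α : Type*}

/-- The domain of the `n`-th iterate: `x, f x, …, f^(n-1) x` all lie in the domain `D` of `f`. -/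
def iterDom (D : Set α) (f : α → α) (n : ℕ) : Set α :=
  {x | ∀ k < n, f^[k] x ∈ D}

/-- The preimage `f^{-n}(S)` under the `n`-th iterate of the partial map. -/
def preimageIter (D : Set α) (f : α → α) (n : ℕ) (S : Set α) : Set α :=
  {x | x ∈ iterDom D f n ∧ f^[n] x ∈ S}

/-- The image `f^n(S)` under the `n`-th iterate of the partial map. -/
def imageIter (D : Set α) (f : α → α) (n : ℕ) (S : Set α) : Set α :=
  {y | ∃ x ∈ S, x ∈ iterDom D f n ∧ f^[n] x = y}

/-- The Julia set `⋂ₙ f^{-n}(X)`. -/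
def juliaSet (D : Set α) (f : α → α) (X : Set α) : Set α :=
  ⋂ n : ℕ, preimageIter D f n X

/-- The basin of `x₀`: points whose whole forward orbit is defined and converges to `x₀`. -/
def basin [TopologicalSpace α] (D : Set α) (f : α → α) (x₀ : α) : Set α :=
  {x | (∀ n, f^[n] x ∈ D) ∧ Tendsto (fun n => f^[n] x) atTop (𝓝 x₀)}

end Partial

/-! ### Subshifts of finite type -/

section Subshift

variable {N : ℕ}

/-- The one-sided subshift space `Σ_A`, with the topology induced by the product of the discrete
topologies on `Fin N`. -/
def Subshift (A : Matrix (Fin N) (Fin N) ℤ) : Type :=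
  {x : ℕ → Fin N // ∀ k, A (x k) (x (k + 1)) = 1}

instance (A : Matrix (Fin N) (Fin N) ℤ) : TopologicalSpace (Subshift A) :=
  inferInstanceAs (TopologicalSpace {x : ℕ → Fin N // ∀ k, A (x k) (x (k + 1)) = 1})

/-- The left shift on `Σ_A`. -/
def shift (A : Matrix (Fin N) (Fin N) ℤ) (x : Subshift A) : Subshift A :=
  ⟨fun k => x.1 (k + 1), fun k => x.2 (k + 1)⟩

/-- The all-ones matrix; its subshift is the full shift on `N` symbols. -/
def fullMatrix (N : ℕ) : Matrix (Fin N) (Fin N) ℤ := fun _ _ => 1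

/-- Topological conjugacy of two subshifts of finite type. -/
def TopConj {M : ℕ} (A : Matrix (Fin N) (Fin N) ℤ) (B : Matrix (Fin M) (Fin M) ℤ) : Prop :=
  ∃ h : Subshift A ≃ₜ Subshift B, ∀ x, h (shift A x) = shift B (h x)

/-- The `(m+3) × (m+3)` matrix (rows and columns numbered from `0`)
```
  e₁ᵀ  I_m  0ᵀ  0ᵀ
  0    0    1   1
  1    1    1   1
  1    1    1   1
```
where the blocks of columns have widths `1, m, 1, 1` and the blocks of rows have heights
`m, 1, 1, 1`: so row `i < m` has the entry `1` in column `i + 1`, and row `0` also in column `0`. -/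
def matA (m : ℕ) : Matrix (Fin (m + 3)) (Fin (m + 3)) ℤ := fun i j =>
  if (i : ℕ) < m then
    if (j : ℕ) = i + 1 ∨ ((i : ℕ) = 0 ∧ (j : ℕ) = 0) then 1 else 0
  else if (i : ℕ) = m then
    if m + 1 ≤ (j : ℕ) then 1 else 0
  else 1

end Subshift

/-! ### Repellers in `ℚ_[p]` -/

section Repeller

variable {p : ℕ} [Fact p.Prime] {N : ℕ}

/-- `(X, J_f, f)` is a `p`-adic repeller with respect to the decomposition of `X` into the disjoint
balls of centres `a j` and radius `p^{-t}`, on which `f` scales distances by `p^{τ j}`. -/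
structure IsRepeller (D : Set ℚ_[p]) (f : ℚ_[p] → ℚ_[p]) (X : Set ℚ_[p])
    (a : Fin N → ℚ_[p]) (t : ℤ) (τ : Fin N → ℤ) : Prop where
  subset_dom : X ⊆ D
  preimage_subset : preimageIter D f 1 X ⊆ X
  eq_iUnion : X = ⋃ j, Metric.ball (a j) ((p : ℝ) ^ (-t))
  disjoint : ∀ i j, i ≠ j →
    Disjoint (Metric.ball (a i) ((p : ℝ) ^ (-t))) (Metric.ball (a j) ((p : ℝ) ^ (-t)))
  scaling : ∀ j, ∀ x ∈ Metric.ball (a j) ((p : ℝ) ^ (-t)),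
    ∀ y ∈ Metric.ball (a j) ((p : ℝ) ^ (-t)), ‖f x - f y‖ = (p : ℝ) ^ (τ j) * ‖x - y‖
  pos : ∀ j, 0 < τ j

open Classical in
/-- The incidence matrix: the entry `(i, j)` is `1` when `f(B(a i)) ∩ B(a j) ≠ ∅`, else `0`. -/
def incidence (f : ℚ_[p] → ℚ_[p]) (a : Fin N → ℚ_[p]) (t : ℤ) : Matrix (Fin N) (Fin N) ℤ :=
  fun i j =>
    if (Metric.ball (a j) ((p : ℝ) ^ (-t)) ∩
      f '' Metric.ball (a i) ((p : ℝ) ^ (-t))).Nonempty then 1 else 0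

/-- The metric `d_f` on `Σ_A`: if `n` is the first index at which `x` and `y` differ, then
`d_f(x, y) = p^{-τ(x₀) - … - τ(x_{n-1}) - κ(x_n, y_n)}` with `|a i - a j| = p^{-κ(i, j)}`. -/
def dyn (a : Fin N → ℚ_[p]) (τ : Fin N → ℤ) {A : Matrix (Fin N) (Fin N) ℤ}
    (x y : Subshift A) : ℝ :=
  open Classical in
  if x = y then 0
  else
    let n := PiNat.firstDiff (E := fun _ => Fin N) x.1 y.1
    (p : ℝ) ^ (-(∑ k ∈ Finset.range n, τ (x.1 k)) - (a (x.1 n) - a (y.1 n)).valuation)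

/-- `f : J → J` is isometrically conjugate to `(Σ_A, σ, d_f)`. The conjugacy is moreover required
to be a homeomorphism for the product topology of `Σ_A` (so this is the topology of `d_f`). -/
def IsometricConj (f : ℚ_[p] → ℚ_[p]) (J : Set ℚ_[p]) (A : Matrix (Fin N) (Fin N) ℤ)
    (a : Fin N → ℚ_[p]) (τ : Fin N → ℤ) : Prop :=
  ∃ hf : Set.MapsTo f J J, ∃ h : J ≃ₜ Subshift A,
    (∀ x : J, h (hf.restrict f J J x) = shift A (h x)) ∧
    ∀ x y : J, dyn a τ (h x) (h y) = ‖(x : ℚ_[p]) - (y : ℚ_[p])‖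

end Repeller

/-! ### The Potts–Bethe mapping -/

section Map

variable {p : ℕ} [Fact p.Prime]

/-- The pole `x^(∞) = 2 - θ - q`. -/
def pole (θ q : ℚ_[p]) : ℚ_[p] := 2 - θ - q

/-- The domain of the Potts–Bethe mapping. -/
def dom (θ q : ℚ_[p]) : Set ℚ_[p] := {x | x ≠ pole θ q}

/-- The Potts–Bethe mapping (only its values on `dom θ q` matter). -/
def pb (θ q : ℚ_[p]) (x : ℚ_[p]) : ℚ_[p] := ((θ * x + q - 1) / (x + θ + q - 2)) ^ 3

/-- `y₁, y₂, y₃` are the three roots (with multiplicity) of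
`y³ - (1+θ+θ²)y² - (2θ+1)(1-θ-q)y - (1-θ-q)²`, numbered so that
`|y₁| = 1 > |y₂| = |y₃| = |1-θ-q|`. -/
structure IsRootTriple (θ q y₁ y₂ y₃ : ℚ_[p]) : Prop where
  factor : ∀ y : ℚ_[p],
    y ^ 3 - (1 + θ + θ ^ 2) * y ^ 2 - (2 * θ + 1) * (1 - θ - q) * y - (1 - θ - q) ^ 2 =
      (y - y₁) * (y - y₂) * (y - y₃)
  norm_one : ‖y₁‖ = 1
  norm_two : ‖y₂‖ = ‖1 - θ - q‖
  norm_three : ‖y₃‖ = ‖1 - θ - q‖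
  lt_one : ‖1 - θ - q‖ < 1

/-- The point `1 - q + (θ - 1)(y - 1)`; it is the fixed point `x^(i)` when `y = y_i`. -/
def fixPt (θ q y : ℚ_[p]) : ℚ_[p] := 1 - q + (θ - 1) * (y - 1)

/-- The radius `r = |q| |θ - 1|`. -/
def rad (θ q : ℚ_[p]) : ℝ := ‖q‖ * ‖θ - 1‖

/-- `𝒞_i` for `i = 2, 3`, with `x = x^(i)`. -/
def setC (θ q x : ℚ_[p]) : Set ℚ_[p] :=
  {z | ‖z - x‖ < ‖z - pole θ q‖ ∧ ‖z - pole θ q‖ = ‖q‖ * ‖θ - 1‖}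

/-- The sphere `𝒢_l` of centre `x₁ = x^(1)` and radius `|θ-1|^{l+1} / |q|^l`. -/
def setG (θ q x₁ : ℚ_[p]) (l : ℕ) : Set ℚ_[p] :=
  {z | ‖z - x₁‖ = ‖θ - 1‖ ^ (l + 1) / ‖q‖ ^ l}

/-- `ℋ_l`: the union of the balls of radius `r` contained in `𝒢_l` whose image under `f^l`
contains `𝒞₂ ∪ 𝒞₃`. -/
def setH (θ q x₁ x₂ x₃ : ℚ_[p]) (l : ℕ) : Set ℚ_[p] :=
  ⋃ (b : ℚ_[p]) (_ : Metric.ball b (rad θ q) ⊆ setG θ q x₁ l ∧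
      setC θ q x₂ ∪ setC θ q x₃ ⊆
        imageIter (dom θ q) (pb θ q) l (Metric.ball b (rad θ q))),
    Metric.ball b (rad θ q)

/-- `𝕏_m = 𝒟₁ ∪ ℋ_m ∪ ⋯ ∪ ℋ_1 ∪ 𝒞₂ ∪ 𝒞₃` with `𝒟₁` the ball of centre `x₁` and radius `r`. -/
def setX (θ q x₁ x₂ x₃ : ℚ_[p]) (m : ℕ) : Set ℚ_[p] :=
  Metric.ball x₁ (rad θ q) ∪ (⋃ l ∈ Finset.Icc 1 m, setH θ q x₁ x₂ x₃ l) ∪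
    setC θ q x₂ ∪ setC θ q x₃

/-- The balls of centres `a 0, …, a (m+2)` and radius `p^{-t} = r` are, in this order,
`𝒟₁, ℋ_m, …, ℋ_1, 𝒞₂, 𝒞₃`. -/
structure IsCoding (θ q x₁ x₂ x₃ : ℚ_[p]) (m : ℕ) (a : Fin (m + 3) → ℚ_[p]) (t : ℤ) : Prop where
  radius : (p : ℝ) ^ (-t) = rad θ q
  first : ∀ i : Fin (m + 3), (i : ℕ) = 0 →
    Metric.ball (a i) (rad θ q) = Metric.ball x₁ (rad θ q)
  middle : ∀ (i : Fin (m + 3)) (l : ℕ), 1 ≤ (i : ℕ) → 1 ≤ l → (i : ℕ) + l = m + 1 →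
    Metric.ball (a i) (rad θ q) = setH θ q x₁ x₂ x₃ l
  penultimate : ∀ i : Fin (m + 3), (i : ℕ) = m + 1 →
    Metric.ball (a i) (rad θ q) = setC θ q x₂
  last : ∀ i : Fin (m + 3), (i : ℕ) = m + 2 →
    Metric.ball (a i) (rad θ q) = setC θ q x₃

end Map

end PottsBethe

end

open PottsBethe

/-! The map is the cube of the Möbius map g(x) = θ + (θ-1)(1-θ-q)/(x - x^(∞)), and here |1-θ-q| =
|q|. As 3 is a p-adic unit, cubing is an isometry on each residue disc of units. So |f(x)-f(y)| =
r|x-y| / (|x-x^(∞)||y-x^(∞)|), with r = |q||θ-1|, whenever g(x) and g(y) are congruent units;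
Hensel's lemma makes f surjective between the corresponding balls (`norm_pb_sub`, `image_pb_ball`).

The distance to the pole then governs the dynamics. Beyond |θ-1|, points fall into the ball |x-1| <
|q|, which f contracts to 1. At distance at most |θ-1|, a point leaves this region at the next step
unless it lies on the bounding sphere, where f expands by |q|/|θ-1|, or in 𝒞₂ ∪ 𝒞₃, where g is close
to a primitive cube root of unity and f expands by 1/r (`sphere_or_near_of_stay`).

On the sphere, x^(1) is a repelling fixed point, and the inverse branch at x^(1) produces a backward
orbit b_l of the pole with |b_l - x^(1)| = |θ-1|(|θ-1|/|q|)^l. The set ℋ_l is the ball of radius r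
about b_l (`setH_eq_ball`). The hypotheses say exactly that b_m is outside 𝒟₁ and b_(m+1) inside it.
This closes X_m under preimages and, together with comparison of the image radii |q|² and 1 with the
distances between centres, gives the matrix A_m.

Symbolic coding holds for any expanding system of equal disjoint balls whose images are balls.
Finally, merging the states 𝒟₁, ℋ_m, …, ℋ_1 of A_m into one symbol gives the full 3-shift, since the
merged state is recovered from the time until the next other symbol. -/

namespace PottsBethe

/-! ### The matrix A_m: irreducibility and recoding to the full 3-shift -/

section Combinatorics

lemma matA_eq_zero_or_one (m : ℕ) (i j : Fin (m + 3)) : matA m i j = 0 ∨ matA m i j = 1 := by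
  unfold matA; split_ifs <;> simp

lemma matA_eq_one_iff (m : ℕ) (i j : Fin (m + 3)) :
    matA m i j = 1 ↔ ((i : ℕ) < m ∧ ((j : ℕ) = i + 1 ∨ ((i : ℕ) = 0 ∧ (j : ℕ) = 0))) ∨
      ((i : ℕ) = m ∧ m + 1 ≤ (j : ℕ)) ∨ m < (i : ℕ) := by
  unfold matA; split_ifs <;> omega

/-- The edges i → i+1 lead every state up to m+1, whose row is full, so m+1 leads in one step to any
state. -/
lemma matA_isIrreducible (m : ℕ) : (matA m).IsIrreducible := by
  refine ⟨fun i j => ?_, ?_⟩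
  · rcases matA_eq_zero_or_one m i j with h | h <;> simp [h]
  let : Quiver (Fin (m + 3)) := (matA m).toQuiver
  have edge : ∀ i j : Fin (m + 3), matA m i j = 1 → Nonempty (i ⟶ j) :=
    fun i j h => ⟨⟨by rw [h]; exact one_pos⟩⟩
  have to_top : ∀ (d : ℕ) (i : Fin (m + 3)), (i : ℕ) + d = m + 1 →
      Nonempty (Quiver.Path i (⟨m + 1, by omega⟩ : Fin (m + 3))) := by
    intro d
    induction d with
    | zero =>
      intro i hi
      have h : i = ⟨m + 1, by omega⟩ := Fin.ext (by simpa using hi)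
      rw [h]
      exact ⟨Quiver.Path.nil⟩
    | succ d ih =>
      intro i hi
      obtain ⟨π⟩ := ih ⟨i + 1, by omega⟩ (by simp; omega)
      obtain ⟨ε⟩ := edge i ⟨i + 1, by omega⟩ ((matA_eq_one_iff m _ _).2 (by simp; omega))
      exact ⟨(Quiver.Hom.toPath ε).comp π⟩
  intro i j
  have hpath : Nonempty (Quiver.Path i (⟨m + 1, by omega⟩ : Fin (m + 3))) := by
    by_cases hi : (i : ℕ) ≤ m + 1
    · exact to_top (m + 1 - i) i (by omega)
    · obtain ⟨ε⟩ := edge i ⟨m + 1, by omega⟩ ((matA_eq_one_iff m _ _).2 (by omega))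
      exact ⟨Quiver.Hom.toPath ε⟩
  obtain ⟨π⟩ := hpath
  obtain ⟨ε⟩ := edge ⟨m + 1, by omega⟩ j ((matA_eq_one_iff m _ _).2 (by simp))
  exact ⟨π.cons ε, by simp⟩

instance {N : ℕ} (A : Matrix (Fin N) (Fin N) ℤ) : T2Space (Subshift A) :=
  inferInstanceAs (T2Space {x : ℕ → Fin N // ∀ k, A (x k) (x (k + 1)) = 1})

instance {N : ℕ} (A : Matrix (Fin N) (Fin N) ℤ) : CompactSpace (Subshift A) := by
  refine isCompact_iff_compactSpace.1 (IsClosed.isCompact (X := ℕ → Fin N)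
    (s := {x | ∀ k, A (x k) (x (k + 1)) = 1}) ?_)
  rw [Set.ofPred_forall]
  refine isClosed_iInter fun k => ?_
  have hc : Continuous fun x : ℕ → Fin N => (x k, x (k + 1)) :=
    (continuous_apply k).prodMk (continuous_apply (k + 1))
  exact (isClosed_discrete {z : Fin N × Fin N | A z.1 z.2 = 1}).preimage hc

/-- The symbol of the full shift to which a state of `matA m` is collapsed. -/
def collapse (m : ℕ) (i : Fin (m + 3)) : Fin 3 := ⟨i - m, by omega⟩

/-- The collapsing map from the subshift of `matA m` to the full shift on three symbols. -/
def collapseShift (m : ℕ) (x : Subshift (matA m)) : Subshift (fullMatrix 3) :=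
  ⟨fun k => collapse m (x.1 k), fun _ => rfl⟩

lemma exists_waiting (m : ℕ) (z : ℕ → Fin 3) (k : ℕ) : ∃ n, n = m + 1 ∨ z (k + n) ≠ 0 :=
  ⟨m + 1, Or.inl rfl⟩

open Classical in
/-- The time until the next nonzero symbol of `z` from position `k` on, truncated at `m + 1`. -/
def waiting (m : ℕ) (z : ℕ → Fin 3) (k : ℕ) : ℕ := Nat.find (exists_waiting m z k)

lemma waiting_eq {m : ℕ} {z : ℕ → Fin 3} {k n : ℕ} (h : n = m + 1 ∨ z (k + n) ≠ 0)
    (h' : ∀ i < n, i ≠ m + 1 ∧ z (k + i) = 0) : waiting m z k = n := by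
  classical
  unfold waiting
  rw [Nat.find_eq_iff]
  refine ⟨h, fun i hi => ?_⟩
  have := h' i hi
  tauto

lemma waiting_le (m : ℕ) (z : ℕ → Fin 3) (k : ℕ) : waiting m z k ≤ m + 1 := by
  classical
  exact Nat.find_min' _ (Or.inl rfl)

lemma waiting_spec (m : ℕ) (z : ℕ → Fin 3) (k : ℕ) :
    waiting m z k = m + 1 ∨ z (k + waiting m z k) ≠ 0 := by
  classical
  exact Nat.find_spec (exists_waiting m z k)

lemma waiting_min {m : ℕ} {z : ℕ → Fin 3} {k n : ℕ} (h : n < waiting m z k) :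
    z (k + n) = 0 := by
  classical
  have := Nat.find_min (exists_waiting m z k) h
  tauto

/-- The state of `matA m` at position `k` in the expansion of `z`. -/
def expand (m : ℕ) (z : ℕ → Fin 3) (k : ℕ) : Fin (m + 3) :=
  if waiting m z k = 0 then ⟨m + z k, by omega⟩ else ⟨m + 1 - waiting m z k, by omega⟩

lemma waiting_zero_iff (m : ℕ) (z : ℕ → Fin 3) (k : ℕ) : waiting m z k = 0 ↔ z k ≠ 0 := by
  constructor
  · intro h
    have := waiting_spec m z k
    rw [h] at this
    simpa using this
  · intro h
    exact waiting_eq (Or.inr (by simpa using h)) (by simp)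

lemma collapse_expand (m : ℕ) (z : ℕ → Fin 3) (k : ℕ) : collapse m (expand m z k) = z k := by
  unfold expand collapse
  by_cases h : waiting m z k = 0
  · simp [h]
  · have hz : z k = 0 := by
      by_contra hz
      exact h ((waiting_zero_iff m z k).2 hz)
    simp only [h, if_false, hz]
    apply Fin.ext
    simp
    omega

/-- A countdown loses one at each step; only the truncated value m+1 can also persist, which
corresponds to the loop at state 0. -/
lemma waiting_succ {m : ℕ} {z : ℕ → Fin 3} {k n : ℕ} (hn : n < m + 1)
    (h : waiting m z k = n + 1) :
    waiting m z (k + 1) = n ∨ (n = m ∧ waiting m z (k + 1) = m + 1) := by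
  have hz : ∀ i < n, z (k + 1 + i) = 0 := fun i hi => by
    rw [add_assoc, add_comm 1 i]; exact waiting_min (m := m) (by omega)
  by_cases hz' : z (k + 1 + n) = 0
  · rcases waiting_spec m z k with h1 | h1
    · right
      refine ⟨by omega, waiting_eq (Or.inl rfl) fun i hi => ⟨by omega, ?_⟩⟩
      rcases Nat.lt_or_ge i n with h2 | h2
      · exact hz i h2
      · obtain rfl : i = n := by omega
        exact hz'
    · rw [h, add_comm n 1, ← add_assoc] at h1
      exact absurd hz' h1
  · exact Or.inl (waiting_eq (Or.inr hz') fun i hi => ⟨by omega, hz i hi⟩)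

/-- The countdown n sits in state m+1-n, so decreasing it follows an edge i → i+1. The assumption 1
≤ m provides the loop at state 0: for m = 0 that state would be the row with entries only in the
last two columns. -/
lemma expand_mem (m : ℕ) (hm : 1 ≤ m) (z : ℕ → Fin 3) (k : ℕ) :
    matA m (expand m z k) (expand m z (k + 1)) = 1 := by
  rw [matA_eq_one_iff]
  have hle := waiting_le m z k
  rcases Nat.eq_zero_or_pos (waiting m z k) with h | h
  · right; right
    have h' := (waiting_zero_iff m z k).1 h
    have : (z k : ℕ) ≠ 0 := fun h0 => h' (Fin.ext h0)
    simp [expand, h]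
    omega
  · obtain ⟨n, hn⟩ : ∃ n, waiting m z k = n + 1 := ⟨_, (Nat.succ_pred_eq_of_pos h).symm⟩
    have hk : ((expand m z k : Fin (m + 3)) : ℕ) = m - n := by
      simp [expand, hn]
    rw [hk]
    rcases waiting_succ (by omega) hn with h1 | ⟨h1, h2⟩
    · by_cases hn0 : n = 0
      · subst hn0
        have h' := (waiting_zero_iff m z (k + 1)).1 h1
        have : (z (k + 1) : ℕ) ≠ 0 := fun h0 => h' (Fin.ext h0)
        simp [expand, h1]
        omega
      · simp [expand, h1, hn0]
        omega
    · simp [expand, h2]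
      omega

/-- From a state i with 1 ≤ i ≤ m the path is forced up to m and then into {m+1, m+2}, so the next
nonzero symbol comes after exactly m+1-i steps. From state 0 the path needs at least m+1 steps to
pass m, which gives the truncated waiting time. -/
lemma expand_collapse (m : ℕ) (x : Subshift (matA m)) (k : ℕ) :
    expand m (fun k => collapse m (x.1 k)) k = x.1 k := by
  have hx := fun k => (matA_eq_one_iff m _ _).1 (x.2 k)
  have hc : ∀ k, collapse m (x.1 k) = 0 ↔ (x.1 k : ℕ) ≤ m := fun k => by
    unfold collapse
    rw [Fin.ext_iff]
    simp
    omega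
  have hup : ∀ n, 1 ≤ (x.1 k : ℕ) → (x.1 k : ℕ) + n ≤ m → (x.1 (k + n) : ℕ) = x.1 k + n := by
    intro n h1
    induction n with
    | zero => simp
    | succ n ih =>
      intro h2
      have h3 := ih (by omega)
      have h4 := hx (k + n)
      rw [← add_assoc]
      omega
  have hlow : ∀ n, (x.1 k : ℕ) = 0 → n ≤ m → (x.1 (k + n) : ℕ) ≤ n := by
    intro n h1
    induction n with
    | zero => simp [h1]
    | succ n ih =>
      intro h2
      have h3 := ih (by omega)
      have h4 := hx (k + n)
      rw [← add_assoc]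
      omega
  set z : ℕ → Fin 3 := fun k => collapse m (x.1 k) with hz
  rcases Nat.lt_or_ge m (x.1 k : ℕ) with h | h
  · have : waiting m z k = 0 := (waiting_zero_iff m z k).2 (by rw [hz, ne_eq, hc]; omega)
    apply Fin.ext
    have h1 : (z k : ℕ) = x.1 k - m := rfl
    simp only [expand, this, if_true]
    omega
  · have : waiting m z k = m + 1 - x.1 k := by
      rcases Nat.eq_zero_or_pos (x.1 k : ℕ) with h0 | h0
      · refine waiting_eq (Or.inl (by omega)) fun i hi => ⟨by omega, ?_⟩
        rw [hz]
        simp only [hc]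
        have := hlow i h0 (by omega)
        omega
      · refine waiting_eq (Or.inr ?_) fun i hi => ⟨by omega, ?_⟩
        · rw [hz]
          simp only [ne_eq, hc]
          have h1 := hup (m - x.1 k) h0 (by omega)
          have h2 := hx (k + (m - x.1 k))
          rw [show k + (m + 1 - (x.1 k : ℕ)) = k + (m - x.1 k) + 1 by omega]
          omega
        · rw [hz]
          simp only [hc]
          have := hup i h0 (by omega)
          omega
    apply Fin.ext
    have h1 : m + 1 - (x.1 k : ℕ) ≠ 0 := by omega
    simp only [expand, this, h1, if_false]
    omega

lemma collapseShift_bijective (m : ℕ) (hm : 1 ≤ m) : Function.Bijective (collapseShift m) := by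
  constructor
  · intro x y h
    have h' : (fun k => collapse m (x.1 k)) = fun k => collapse m (y.1 k) :=
      congrArg Subtype.val h
    apply Subtype.ext
    funext k
    rw [← expand_collapse m x k, ← expand_collapse m y k, h']
  · intro z
    exact ⟨⟨expand m z.1, expand_mem m hm z.1⟩,
      Subtype.ext (funext fun k => collapse_expand m z.1 k)⟩

lemma collapseShift_continuous (m : ℕ) : Continuous (collapseShift m) :=
  Continuous.subtype_mk (continuous_pi fun k =>
    (continuous_of_discreteTopology (f := collapse m)).comp
      ((continuous_apply k).comp continuous_subtype_val)) _

theorem topConj_matA_fullMatrix (m : ℕ) (hm : 1 ≤ m) : TopConj (matA m) (fullMatrix 3) :=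
  ⟨(collapseShift_continuous m).homeoOfEquivCompactToT2
    (f := Equiv.ofBijective _ (collapseShift_bijective m hm)), fun _ => rfl⟩

end Combinatorics

end PottsBethe
namespace PottsBethe

/-! ### Symbolic coding of a p-adic repeller -/

section Coding

variable {p : ℕ} [Fact p.Prime] {N : ℕ} {D X : Set ℚ_[p]} {f : ℚ_[p] → ℚ_[p]}
  {a : Fin N → ℚ_[p]} {t : ℤ} {τ : Fin N → ℤ}

lemma norm_sub_le_max {E : Type*} [SeminormedAddCommGroup E] [IsUltrametricDist E] (x y : E) :
    ‖x - y‖ ≤ max ‖x‖ ‖y‖ := by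
  rw [sub_eq_add_neg, ← norm_neg y]
  exact IsUltrametricDist.norm_add_le_max _ _

lemma mem_juliaSet_iff {α : Type*} {D X : Set α} {f : α → α} (h : X ⊆ D) {x : α} :
    x ∈ juliaSet D f X ↔ ∀ n, f^[n] x ∈ X := by
  simp only [juliaSet, preimageIter, iterDom, Set.mem_iInter]
  exact ⟨fun hx n => (hx n).2, fun hx n => ⟨fun k _ => h (hx k), hx n⟩⟩

lemma prime_cast_pos : (0 : ℝ) < p := by exact_mod_cast (Fact.out : p.Prime).pos

lemma one_lt_prime_cast : (1 : ℝ) < p := by exact_mod_cast (Fact.out : p.Prime).one_lt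

lemma IsRepeller.continuousOn (h : IsRepeller D f X a t τ) : ContinuousOn f X := by
  intro x hx
  rw [h.eq_iUnion, Set.mem_iUnion] at hx
  obtain ⟨j, hj⟩ := hx
  have hc : ContinuousOn f (Metric.ball (a j) ((p : ℝ) ^ (-t))) := by
    refine (LipschitzOnWith.of_dist_le_mul (K := ((p : NNReal) ^ (τ j))) ?_).continuousOn
    intro x hx y hy
    rw [dist_eq_norm, dist_eq_norm, h.scaling j x hx y hy]
    simp
  exact (hc.continuousAt (Metric.isOpen_ball.mem_nhds hj)).continuousWithinAt

lemma IsRepeller.isClosed (h : IsRepeller D f X a t τ) : IsClosed X := by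
  rw [h.eq_iUnion]
  exact isClosed_iUnion_of_finite fun j => IsUltrametricDist.isClosed_ball _ _

lemma IsRepeller.isBounded (h : IsRepeller D f X a t τ) : Bornology.IsBounded X := by
  rw [h.eq_iUnion, Bornology.isBounded_iUnion]
  exact fun j => Metric.isBounded_ball

/-- Since f is continuous only on X, iterates are not globally continuous; closedness is pulled back
one step at a time through sets contained in X. -/
lemma isClosed_setOf_forall_iterate_mem {α : Type*} [TopologicalSpace α] {f : α → α} {X : Set α}
    (hf : ContinuousOn f X) (n : ℕ) (S : ℕ → Set α) (hS : ∀ k, IsClosed (S k))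
    (hSX : ∀ k, S k ⊆ X) : IsClosed {x | ∀ k ≤ n, f^[k] x ∈ S k} := by
  induction n generalizing S with
  | zero => simpa using hS 0
  | succ n ih =>
    have h1 := ih (fun k => S (k + 1)) (fun k => hS _) (fun k => hSX _)
    have h2 := (hf.mono (hSX 0)).preimage_isClosed_of_isClosed (hS 0) h1
    convert h2 using 1
    ext x
    constructor
    · intro hx
      exact ⟨hx 0 (by omega), fun k hk => hx (k + 1) (by omega)⟩
    · rintro ⟨hx0, hx⟩ k hk
      rcases k with _ | k
      · exact hx0
      · exact hx k (by omega)

lemma IsRepeller.norm_iterate_sub (h : IsRepeller D f X a t τ) (u : ℕ → Fin N) {x y : ℚ_[p]}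
    (n : ℕ) (hx : ∀ k < n, f^[k] x ∈ Metric.ball (a (u k)) ((p : ℝ) ^ (-t)))
    (hy : ∀ k < n, f^[k] y ∈ Metric.ball (a (u k)) ((p : ℝ) ^ (-t))) :
    ‖f^[n] x - f^[n] y‖ = (p : ℝ) ^ (∑ k ∈ Finset.range n, τ (u k)) * ‖x - y‖ := by
  induction n with
  | zero => simp
  | succ n ih =>
    rw [Function.iterate_succ_apply', Function.iterate_succ_apply',
      h.scaling (u n) _ (hx n (by omega)) _ (hy n (by omega)),
      ih (fun k hk => hx k (by omega)) (fun k hk => hy k (by omega)), Finset.sum_range_succ,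
      zpow_add₀ prime_cast_pos.ne']
    ring

/-- Each exponent is at least 1, so the distance grows at least like pⁿ, while both orbits share a
ball of radius p^(-t) at every time. -/
lemma IsRepeller.eq_of_same_itinerary (h : IsRepeller D f X a t τ) (u : ℕ → Fin N) {x y : ℚ_[p]}
    (hx : ∀ k, f^[k] x ∈ Metric.ball (a (u k)) ((p : ℝ) ^ (-t)))
    (hy : ∀ k, f^[k] y ∈ Metric.ball (a (u k)) ((p : ℝ) ^ (-t))) : x = y := by
  by_contra hxy
  have hpos : 0 < ‖x - y‖ := norm_pos_iff.2 (sub_ne_zero.2 hxy)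
  have hp1 := one_lt_prime_cast (p := p)
  obtain ⟨n, hn⟩ := pow_unbounded_of_one_lt ((p : ℝ) ^ (-t) / ‖x - y‖) hp1
  have hsum : (n : ℤ) ≤ ∑ k ∈ Finset.range n, τ (u k) := by
    have := Finset.sum_le_sum (s := Finset.range n) (f := fun _ => (1 : ℤ))
      (g := fun k => τ (u k)) fun k _ => h.pos (u k)
    simpa using this
  have h1 := h.norm_iterate_sub u n (fun k _ => hx k) fun k _ => hy k
  have h2 : ‖f^[n] x - f^[n] y‖ < (p : ℝ) ^ (-t) := by
    have := hx n
    rw [IsUltrametricDist.ball_eq_of_mem (hy n), Metric.mem_ball, dist_eq_norm] at this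
    exact this
  have h3 : (p : ℝ) ^ n ≤ (p : ℝ) ^ (∑ k ∈ Finset.range n, τ (u k)) := by
    rw [← zpow_natCast]
    exact zpow_le_zpow_right₀ hp1.le hsum
  rw [div_lt_iff₀ hpos] at hn
  have := mul_le_mul_of_nonneg_right h3 hpos.le
  linarith

lemma incidence_eq_one_iff {i j : Fin N} : incidence f a t i j = 1 ↔
    (Metric.ball (a j) ((p : ℝ) ^ (-t)) ∩ f '' Metric.ball (a i) ((p : ℝ) ^ (-t))).Nonempty := by
  classical
  unfold incidence
  split_ifs with h
  · exact iff_of_true rfl h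
  · exact iff_of_false zero_ne_one h

/-- The Markov property: the image is a ball of larger radius, and an ultrametric ball contains
every smaller ball that it meets. -/
lemma ball_subset_image_of_incidence (hpos : ∀ j, 0 < τ j)
    (himg : ∀ i, f '' Metric.ball (a i) ((p : ℝ) ^ (-t)) =
      Metric.ball (f (a i)) ((p : ℝ) ^ (τ i) * (p : ℝ) ^ (-t)))
    {i j : Fin N} (h : incidence f a t i j = 1) :
    Metric.ball (a j) ((p : ℝ) ^ (-t)) ⊆ f '' Metric.ball (a i) ((p : ℝ) ^ (-t)) := by
  obtain ⟨z, hz1, hz2⟩ := incidence_eq_one_iff.1 h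
  rw [himg] at hz2 ⊢
  rw [IsUltrametricDist.ball_eq_of_mem hz1, IsUltrametricDist.ball_eq_of_mem hz2]
  refine Metric.ball_subset_ball (le_mul_of_one_le_left (zpow_pos prime_cast_pos _).le ?_)
  exact one_le_zpow₀ one_lt_prime_cast.le (hpos i).le

lemma exists_finite_itinerary
    (hM : ∀ i j, incidence f a t i j = 1 →
      Metric.ball (a j) ((p : ℝ) ^ (-t)) ⊆ f '' Metric.ball (a i) ((p : ℝ) ^ (-t)))
    (n : ℕ) (u : ℕ → Fin N) (hu : ∀ k, incidence f a t (u k) (u (k + 1)) = 1) :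
    ∃ x, ∀ k ≤ n, f^[k] x ∈ Metric.ball (a (u k)) ((p : ℝ) ^ (-t)) := by
  induction n generalizing u with
  | zero => exact ⟨a (u 0), fun k hk => by
      obtain rfl := Nat.le_zero.1 hk
      exact Metric.mem_ball_self (zpow_pos prime_cast_pos _)⟩
  | succ n ih =>
    obtain ⟨y, hy⟩ := ih (fun k => u (k + 1)) fun k => hu (k + 1)
    obtain ⟨x, hx, rfl⟩ := hM _ _ (hu 0) (hy 0 (by omega))
    refine ⟨x, fun k hk => ?_⟩
    rcases k with _ | k
    · exact hx
    · exact hy k (by omega)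

/-- Finite itineraries are realised by pulling back along the Markov property; the points realising
longer and longer ones form nested nonempty compact sets. -/
lemma IsRepeller.exists_itinerary (h : IsRepeller D f X a t τ)
    (hM : ∀ i j, incidence f a t i j = 1 →
      Metric.ball (a j) ((p : ℝ) ^ (-t)) ⊆ f '' Metric.ball (a i) ((p : ℝ) ^ (-t)))
    (u : ℕ → Fin N) (hu : ∀ k, incidence f a t (u k) (u (k + 1)) = 1) :
    ∃ x, ∀ k, f^[k] x ∈ Metric.ball (a (u k)) ((p : ℝ) ^ (-t)) := by
  have hcl : ∀ n, IsClosed {x | ∀ k ≤ n, f^[k] x ∈ Metric.ball (a (u k)) ((p : ℝ) ^ (-t))} :=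
    fun n => isClosed_setOf_forall_iterate_mem h.continuousOn n _
      (fun k => IsUltrametricDist.isClosed_ball _ _)
      (fun k => by rw [h.eq_iUnion]; exact Set.subset_iUnion_of_subset (u k) subset_rfl)
  have hcpt : IsCompact
      {x | ∀ k ≤ 0, f^[k] x ∈ Metric.ball (a (u k)) ((p : ℝ) ^ (-t))} :=
    Metric.isCompact_of_isClosed_isBounded (hcl 0)
      ((Metric.isBounded_ball (x := a (u 0)) (r := (p : ℝ) ^ (-t))).subset
        fun x hx => hx 0 le_rfl)
  obtain ⟨x, hx⟩ := IsCompact.nonempty_iInter_of_sequence_nonempty_isCompact_isClosed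
    (fun n => {x | ∀ k ≤ n, f^[k] x ∈ Metric.ball (a (u k)) ((p : ℝ) ^ (-t))})
    (fun n x hx k hk => hx k (by omega)) (fun n => exists_finite_itinerary hM n u hu) hcpt hcl
  rw [Set.mem_iInter] at hx
  exact ⟨x, fun k => hx k k le_rfl⟩

lemma IsRepeller.isCompact_juliaSet (h : IsRepeller D f X a t τ) :
    IsCompact (juliaSet D f X) := by
  have hJ : juliaSet D f X = ⋂ n, {x | ∀ k ≤ n, f^[k] x ∈ X} := by
    ext x
    rw [mem_juliaSet_iff h.subset_dom, Set.mem_iInter]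
    exact ⟨fun hx n k _ => hx k, fun hx n => hx n n le_rfl⟩
  rw [hJ]
  exact Metric.isCompact_of_isClosed_isBounded
    (isClosed_iInter fun n => isClosed_setOf_forall_iterate_mem h.continuousOn n (fun _ => X)
      (fun _ => h.isClosed) fun _ => subset_rfl)
    (h.isBounded.subset fun x hx => (Set.mem_iInter.1 hx 0) 0 le_rfl)

theorem IsRepeller.isometricConj (h : IsRepeller D f X a t τ)
    (himg : ∀ i, f '' Metric.ball (a i) ((p : ℝ) ^ (-t)) =
      Metric.ball (f (a i)) ((p : ℝ) ^ (τ i) * (p : ℝ) ^ (-t))) :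
    IsometricConj f (juliaSet D f X) (incidence f a t) a τ := by
  set J := juliaSet D f X
  have hM := fun i j => ball_subset_image_of_incidence (i := i) (j := j) h.pos himg
  have hJ : ∀ {x}, x ∈ J ↔ ∀ n, f^[n] x ∈ X := mem_juliaSet_iff h.subset_dom
  have hf : Set.MapsTo f J J := fun x hx => hJ.2 fun n => hJ.1 hx (n + 1)
  have hex : ∀ (x : J) (n : ℕ), ∃ j, f^[n] x ∈ Metric.ball (a j) ((p : ℝ) ^ (-t)) := by
    intro x n
    have := hJ.1 x.2 n
    rwa [h.eq_iUnion, Set.mem_iUnion] at this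
  choose c hc using hex
  have huniq : ∀ {z : ℚ_[p]} {i j : Fin N}, z ∈ Metric.ball (a i) ((p : ℝ) ^ (-t)) →
      z ∈ Metric.ball (a j) ((p : ℝ) ^ (-t)) → i = j := by
    intro z i j hi hj
    by_contra hij
    exact Set.disjoint_left.1 (h.disjoint i j hij) hi hj
  have hcA : ∀ x k, incidence f a t (c x k) (c x (k + 1)) = 1 := fun x k =>
    incidence_eq_one_iff.2 ⟨f^[k + 1] x, hc x (k + 1), f^[k] x, hc x k,
      (Function.iterate_succ_apply' f k _).symm⟩
  let H : J → Subshift (incidence f a t) := fun x => ⟨c x, hcA x⟩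
  have hinj : Function.Injective H := by
    intro x y hxy
    have hcxy : c x = c y := congrArg Subtype.val hxy
    exact Subtype.ext (h.eq_of_same_itinerary (c x) (hc x) fun k => by rw [hcxy]; exact hc y k)
  have hsurj : Function.Surjective H := by
    intro u
    obtain ⟨x, hx⟩ := h.exists_itinerary hM u.1 u.2
    have hxJ : x ∈ J := hJ.2 fun n => by
      rw [h.eq_iUnion]
      exact Set.mem_iUnion.2 ⟨_, hx n⟩
    exact ⟨⟨x, hxJ⟩, Subtype.ext (funext fun k => huniq (hc ⟨x, hxJ⟩ k) (hx k))⟩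
  have hiter : ∀ n, Continuous fun x : J => f^[n] x := by
    intro n
    induction n with
    | zero => exact continuous_subtype_val
    | succ n ih =>
      have : (fun x : J => f^[n + 1] (x : ℚ_[p])) = fun x : J => f (f^[n] x) :=
        funext fun x => Function.iterate_succ_apply' f n _
      rw [this]
      exact h.continuousOn.comp_continuous ih fun x => hJ.1 x.2 n
  have hcont : Continuous H := by
    refine Continuous.subtype_mk (continuous_pi fun k => ?_) _
    refine continuous_discrete_rng.2 fun j => ?_
    convert (hiter k).isOpen_preimage _ (Metric.isOpen_ball (x := a j) (ε := (p : ℝ) ^ (-t)))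
      using 1
    ext x
    exact ⟨fun hx => by have := hc x k; rwa [show c x k = j from hx] at this,
      fun hx => huniq (hc x k) hx⟩
  have : CompactSpace J := isCompact_iff_compactSpace.1 h.isCompact_juliaSet
  -- The itinerary map is a continuous bijection from a compact space to a Hausdorff one.
  refine ⟨hf, hcont.homeoOfEquivCompactToT2 (f := Equiv.ofBijective H ⟨hinj, hsurj⟩), ?_, ?_⟩
  · intro x
    exact Subtype.ext (funext fun k => huniq (hc _ k) (hc x (k + 1)))
  · intro x y
    change dyn a τ (H x) (H y) = _
    unfold dyn
    split_ifs with hxy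
    · rw [hinj hxy]
      simp
    · have hne : c x ≠ c y := fun h' => hxy (Subtype.ext h')
      have hd := PiNat.apply_firstDiff_ne (E := fun _ => Fin N) hne
      have hlt := fun k => PiNat.apply_eq_of_lt_firstDiff (E := fun _ => Fin N)
        (x := c x) (y := c y) (n := k)
      change (p : ℝ) ^ (-(∑ k ∈ Finset.range (PiNat.firstDiff (E := fun _ => Fin N) (c x) (c y)),
        τ (c x k)) - (a (c x (PiNat.firstDiff (E := fun _ => Fin N) (c x) (c y))) -
          a (c y (PiNat.firstDiff (E := fun _ => Fin N) (c x) (c y)))).valuation) = _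
      generalize PiNat.firstDiff (E := fun _ => Fin N) (c x) (c y) = n at hd hlt ⊢
      have h1 := h.norm_iterate_sub (c x) n (fun k _ => hc x k)
        fun k hk => by rw [hlt k hk]; exact hc y k
      have hxn := hc x n
      have hyn := hc y n
      -- Disjoint balls have centres at least p^(-t) apart, hence points in them are exactly as far
      -- apart as the centres. Undoing the n expansions gives the formula of `dyn`.
      have hdisj : (p : ℝ) ^ (-t) ≤ ‖a (c x n) - a (c y n)‖ := by
        by_contra! hlt'
        exact hd (huniq (z := a (c x n)) (Metric.mem_ball_self (zpow_pos prime_cast_pos _))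
          (by rwa [Metric.mem_ball, dist_eq_norm]))
      have h2 : ‖f^[n] x - f^[n] y‖ = ‖a (c x n) - a (c y n)‖ := by
        rw [Metric.mem_ball, dist_eq_norm] at hxn hyn
        have h3 : ‖(f^[n] x - a (c x n)) - (f^[n] y - a (c y n))‖ < ‖a (c x n) - a (c y n)‖ :=
          lt_of_lt_of_le ((norm_sub_le_max _ _).trans_lt (max_lt hxn hyn)) hdisj
        rw [show (f^[n] x : ℚ_[p]) - f^[n] y = ((f^[n] x - a (c x n)) - (f^[n] y - a (c y n))) +
          (a (c x n) - a (c y n)) by ring,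
          IsUltrametricDist.norm_add_eq_max_of_norm_ne_norm h3.ne, max_eq_right h3.le]
      have hane : a (c x n) - a (c y n) ≠ 0 := by
        rw [← norm_pos_iff]
        exact lt_of_lt_of_le (zpow_pos prime_cast_pos _) hdisj
      have h4 := Padic.norm_eq_zpow_neg_valuation hane
      rw [sub_eq_add_neg, zpow_add₀ prime_cast_pos.ne', ← h4, ← h2, h1, zpow_neg, ← mul_assoc,
        inv_mul_cancel₀ (zpow_pos prime_cast_pos _).ne', one_mul]

end Coding

end PottsBethe
namespace PottsBethe

/-! ### Ultrametric inequalities and Hensel's lemma -/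

section Ultrametric

lemma norm_eq_of_norm_sub_lt {E : Type*} [SeminormedAddCommGroup E] [IsUltrametricDist E]
    {x y : E} (h : ‖x - y‖ < ‖y‖) : ‖x‖ = ‖y‖ := by
  have := IsUltrametricDist.norm_add_eq_max_of_norm_ne_norm h.ne
  rwa [sub_add_cancel, max_eq_right h.le] at this

lemma norm_sub_eq_of_lt {E : Type*} [SeminormedAddCommGroup E] [IsUltrametricDist E]
    {x y z : E} (h : ‖x - y‖ < ‖y - z‖) : ‖x - z‖ = ‖y - z‖ :=
  norm_eq_of_norm_sub_lt (by rwa [sub_sub_sub_cancel_right])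

lemma norm_sub_lt_of_lt {E : Type*} [SeminormedAddCommGroup E] [IsUltrametricDist E]
    {x y z : E} {ρ : ℝ} (h : ‖x - y‖ < ρ) (h' : ‖y - z‖ < ρ) : ‖x - z‖ < ρ := by
  rw [← sub_add_sub_cancel x y z]
  exact (IsUltrametricDist.norm_add_le_max _ _).trans_lt (max_lt h h')

lemma norm_add_lt_of_lt {E : Type*} [SeminormedAddCommGroup E] [IsUltrametricDist E]
    {x y : E} {ρ : ℝ} (h : ‖x‖ < ρ) (h' : ‖y‖ < ρ) : ‖x + y‖ < ρ :=
  (IsUltrametricDist.norm_add_le_max _ _).trans_lt (max_lt h h')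

lemma norm_sub_le_of_le {E : Type*} [SeminormedAddCommGroup E] [IsUltrametricDist E]
    {x y z : E} {ρ : ℝ} (h : ‖x - y‖ ≤ ρ) (h' : ‖y - z‖ ≤ ρ) : ‖x - z‖ ≤ ρ := by
  rw [← sub_add_sub_cancel x y z]
  exact (IsUltrametricDist.norm_add_le_max _ _).trans (max_le h h')

end Ultrametric

section Hensel

variable {p : ℕ} [Fact p.Prime]

lemma norm_natCast_eq_one_of_lt {n : ℕ} (h0 : 0 < n) (h : n < p) : ‖(n : ℚ_[p])‖ = 1 := by
  rw [Padic.norm_natCast_eq_one_iff]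
  exact ((Fact.out : p.Prime).coprime_iff_not_dvd).2 (Nat.not_dvd_of_pos_of_lt h0 h)

lemma exists_root_of_norm_lt_one (F : Polynomial ℤ_[p]) (a : ℤ_[p]) (h : ‖F.eval a‖ < 1)
    (h' : ‖F.derivative.eval a‖ = 1) : ∃ z : ℤ_[p], F.eval z = 0 ∧ ‖z - a‖ < 1 := by
  obtain ⟨z, hz, hza, -⟩ := hensels_lemma (F := F) (a := a)
    (by simp only [Polynomial.coe_aeval_eq_eval]; rw [h']; simpa using h)
  simp only [Polynomial.coe_aeval_eq_eval] at hz hza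
  exact ⟨z, hz, h' ▸ hza⟩

-- Hensel's lemma for Xⁿ - c at a: the derivative n·aⁿ⁻¹ is a unit.
open Polynomial in
lemma exists_pow_eq_of_norm_lt_one {n : ℕ} (hn : ‖(n : ℚ_[p])‖ = 1) {a c : ℚ_[p]} (ha : ‖a‖ = 1)
    (h : ‖c - a ^ n‖ < 1) : ∃ g : ℚ_[p], g ^ n = c ∧ ‖g - a‖ < 1 := by
  have hc : ‖c‖ ≤ 1 := by
    have : ‖a ^ n‖ = 1 := by rw [norm_pow, ha, one_pow]
    rw [← this] at h
    exact ((norm_eq_of_norm_sub_lt h).trans this).le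
  obtain ⟨c, rfl⟩ : ∃ c' : ℤ_[p], (c' : ℚ_[p]) = c := ⟨⟨c, hc⟩, rfl⟩
  obtain ⟨a, rfl⟩ : ∃ a' : ℤ_[p], (a' : ℚ_[p]) = a := ⟨⟨a, ha.le⟩, rfl⟩
  rw [← PadicInt.norm_def] at ha
  obtain ⟨z, hz, hza⟩ := exists_root_of_norm_lt_one ((X : ℤ_[p][X]) ^ n - C c) a
    (by
      rw [← norm_neg]
      simpa [PadicInt.norm_def] using h)
    (by
      have hn' : ‖(n : ℤ_[p])‖ = 1 := by simpa [PadicInt.norm_def] using hn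
      simp [Polynomial.derivative_X_pow, ha, hn'])
  refine ⟨z, ?_, by simpa [PadicInt.norm_def] using hza⟩
  have := congrArg (fun w : ℤ_[p] => (w : ℚ_[p])) hz
  simpa [sub_eq_zero] using this

end Hensel

/-! ### Metric estimates for the Potts–Bethe mapping -/

section Map

variable {p : ℕ} [Fact p.Prime]

/-- The Möbius map whose cube is the Potts–Bethe mapping. -/
noncomputable def mob (θ q x : ℚ_[p]) : ℚ_[p] := (θ * x + q - 1) / (x + θ + q - 2)

lemma pb_eq_mob_pow (θ q x : ℚ_[p]) : pb θ q x = mob θ q x ^ 3 := rfl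

/-- The metric properties of the parameters and of the fixed points of the Potts–Bethe mapping on
which its dynamics depends. -/
structure IsPottsBethe (θ q x₁ x₂ x₃ : ℚ_[p]) (m : ℕ) : Prop where
  one_le : 1 ≤ m
  norm_three : ‖(3 : ℚ_[p])‖ = 1
  q_pos : 0 < ‖q‖
  q_lt_one : ‖q‖ < 1
  eps_pos : 0 < ‖θ - 1‖
  lower : ‖q‖ ^ (m + 1) ≤ ‖θ - 1‖ ^ m
  upper : ‖θ - 1‖ ^ (m + 1) < ‖q‖ ^ (m + 2)
  dist_one : ‖x₁ - pole θ q‖ = ‖θ - 1‖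
  dist_two : ‖x₂ - pole θ q‖ = ‖q‖ * ‖θ - 1‖
  dist_three : ‖x₃ - pole θ q‖ = ‖q‖ * ‖θ - 1‖
  fix_one : pb θ q x₁ = x₁
  fix_two : pb θ q x₂ = x₂
  fix_three : pb θ q x₃ = x₃
  mob_two : ‖mob θ q x₂ ^ 2 + mob θ q x₂ + 1‖ < 1
  mob_three : ‖mob θ q x₃ ^ 2 + mob θ q x₃ + 1‖ < 1
  separated : ‖x₂ - x₃‖ = ‖q‖ * ‖θ - 1‖

namespace IsPottsBethe

variable {θ q x₁ x₂ x₃ : ℚ_[p]} {m : ℕ}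

lemma eps_lt_q (h : IsPottsBethe θ q x₁ x₂ x₃ m) : ‖θ - 1‖ < ‖q‖ := by
  by_contra! hle
  have h1 := pow_le_pow_left₀ h.q_pos.le hle (m + 1)
  have h2 := pow_lt_pow_right_of_lt_one₀ h.q_pos h.q_lt_one (show m + 1 < m + 2 by omega)
  linarith [h.upper]

lemma eps_lt_one (h : IsPottsBethe θ q x₁ x₂ x₃ m) : ‖θ - 1‖ < 1 := h.eps_lt_q.trans h.q_lt_one

lemma rad_pos (h : IsPottsBethe θ q x₁ x₂ x₃ m) : 0 < ‖q‖ * ‖θ - 1‖ := mul_pos h.q_pos h.eps_pos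

lemma rad_lt_eps (h : IsPottsBethe θ q x₁ x₂ x₃ m) : ‖q‖ * ‖θ - 1‖ < ‖θ - 1‖ :=
  mul_lt_of_lt_one_left h.eps_pos h.q_lt_one

lemma norm_aux (h : IsPottsBethe θ q x₁ x₂ x₃ m) : ‖1 - θ - q‖ = ‖q‖ := by
  rw [← norm_neg q]
  refine norm_eq_of_norm_sub_lt ?_
  rw [norm_neg, show 1 - θ - q - -q = -(θ - 1) by ring, norm_neg]
  exact h.eps_lt_q

lemma norm_one_sub_pole (h : IsPottsBethe θ q x₁ x₂ x₃ m) : ‖1 - pole θ q‖ = ‖q‖ := by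
  rw [← h.norm_aux, ← norm_neg]
  congr 1
  unfold pole
  ring

lemma norm_theta (h : IsPottsBethe θ q x₁ x₂ x₃ m) : ‖θ‖ = 1 := by
  rw [← norm_one (α := ℚ_[p])]
  exact norm_eq_of_norm_sub_lt (by rw [norm_one]; exact h.eps_lt_one)

end IsPottsBethe

lemma ne_pole_of_norm_pos {θ q x : ℚ_[p]} (h : 0 < ‖x - pole θ q‖) : x ≠ pole θ q :=
  sub_ne_zero.1 (norm_pos_iff.1 h)

lemma mob_eq {θ q x : ℚ_[p]} (hx : x ≠ pole θ q) :
    mob θ q x = θ + (θ - 1) * (1 - θ - q) / (x - pole θ q) := by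
  have hx' : x - pole θ q ≠ 0 := sub_ne_zero.2 hx
  have h1 : x + θ + q - 2 = x - pole θ q := by unfold pole; ring
  unfold mob
  rw [h1, eq_comm, ← sub_eq_zero]
  field_simp
  unfold pole
  ring

/-- The cofactor b² + ba + a² is congruent to the unit 3a². -/
lemma norm_cube_sub_cube (h3 : ‖(3 : ℚ_[p])‖ = 1) {a b : ℚ_[p]} (ha : ‖a‖ = 1)
    (hab : ‖b - a‖ < 1) : ‖b ^ 3 - a ^ 3‖ = ‖b - a‖ := by
  have h1 : ‖3 * a ^ 2‖ = 1 := by rw [norm_mul, norm_pow, h3, ha]; norm_num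
  have h2 : ‖b ^ 2 + b * a + a ^ 2‖ = 1 := by
    rw [← h1]
    refine norm_eq_of_norm_sub_lt ?_
    rw [h1, show b ^ 2 + b * a + a ^ 2 - 3 * a ^ 2 = (b - a) * ((b - a) + 3 * a) by ring, norm_mul]
    have h4 : ‖b - a + 3 * a‖ ≤ 1 := (IsUltrametricDist.norm_add_le_max _ _).trans
      (max_le hab.le (by rw [norm_mul, h3, ha]; norm_num))
    calc _ ≤ ‖b - a‖ * 1 := by gcongr
      _ < 1 := by rwa [mul_one]
  rw [show b ^ 3 - a ^ 3 = (b - a) * (b ^ 2 + b * a + a ^ 2) by ring, norm_mul, h2, mul_one]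

namespace IsPottsBethe

variable {θ q x₁ x₂ x₃ : ℚ_[p]} {m : ℕ}

lemma norm_mob_sub_theta (h : IsPottsBethe θ q x₁ x₂ x₃ m) {x : ℚ_[p]} (hx : x ≠ pole θ q) :
    ‖mob θ q x - θ‖ = ‖q‖ * ‖θ - 1‖ / ‖x - pole θ q‖ := by
  rw [mob_eq hx, add_sub_cancel_left, norm_div, norm_mul, h.norm_aux, mul_comm ‖q‖]

lemma norm_mob_sub (h : IsPottsBethe θ q x₁ x₂ x₃ m) {x y : ℚ_[p]} (hx : x ≠ pole θ q)
    (hy : y ≠ pole θ q) : ‖mob θ q x - mob θ q y‖ =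
      ‖q‖ * ‖θ - 1‖ * ‖x - y‖ / (‖x - pole θ q‖ * ‖y - pole θ q‖) := by
  have hx' : x - pole θ q ≠ 0 := sub_ne_zero.2 hx
  have hy' : y - pole θ q ≠ 0 := sub_ne_zero.2 hy
  have : mob θ q x - mob θ q y =
      -((1 - θ - q) * (θ - 1) * (x - y)) / ((x - pole θ q) * (y - pole θ q)) := by
    rw [mob_eq hx, mob_eq hy]
    field_simp
    ring
  rw [this, norm_div, norm_neg, norm_mul, norm_mul, norm_mul, h.norm_aux]

lemma norm_pb_sub (h : IsPottsBethe θ q x₁ x₂ x₃ m) {x y : ℚ_[p]} (hx : x ≠ pole θ q)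
    (hy : y ≠ pole θ q) (hm : ‖mob θ q y‖ = 1) (hxy : ‖mob θ q x - mob θ q y‖ < 1) :
    ‖pb θ q x - pb θ q y‖ =
      ‖q‖ * ‖θ - 1‖ * ‖x - y‖ / (‖x - pole θ q‖ * ‖y - pole θ q‖) := by
  rw [pb_eq_mob_pow, pb_eq_mob_pow, norm_cube_sub_cube h.norm_three hm hxy, h.norm_mob_sub hx hy]

section Far

variable {x y : ℚ_[p]}

lemma norm_pos_of_far (h : IsPottsBethe θ q x₁ x₂ x₃ m)
    (hx : ‖q‖ * ‖θ - 1‖ < ‖x - pole θ q‖) : 0 < ‖x - pole θ q‖ := h.rad_pos.trans hx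

/-- Here |g(x) - θ| = r/|x - x^(∞)| < 1 and θ is congruent to 1. Thus all values of g beyond
distance r from the pole lie in the residue disc of 1, where cubing is isometric. -/
lemma norm_mob_sub_one_of_far (h : IsPottsBethe θ q x₁ x₂ x₃ m)
    (hx : ‖q‖ * ‖θ - 1‖ < ‖x - pole θ q‖) : ‖mob θ q x - 1‖ < 1 := by
  have h0 := h.norm_pos_of_far hx
  refine norm_sub_lt_of_lt (y := θ) ?_ h.eps_lt_one
  rw [h.norm_mob_sub_theta (ne_pole_of_norm_pos h0), div_lt_one h0]
  exact hx

lemma norm_mob_of_far (h : IsPottsBethe θ q x₁ x₂ x₃ m)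
    (hx : ‖q‖ * ‖θ - 1‖ < ‖x - pole θ q‖) : ‖mob θ q x‖ = 1 := by
  rw [← norm_one (α := ℚ_[p])]
  exact norm_eq_of_norm_sub_lt (by rw [norm_one]; exact h.norm_mob_sub_one_of_far hx)

lemma norm_pb_sub_of_far (h : IsPottsBethe θ q x₁ x₂ x₃ m)
    (hx : ‖q‖ * ‖θ - 1‖ < ‖x - pole θ q‖) (hy : ‖q‖ * ‖θ - 1‖ < ‖y - pole θ q‖) :
    ‖pb θ q x - pb θ q y‖ =
      ‖q‖ * ‖θ - 1‖ * ‖x - y‖ / (‖x - pole θ q‖ * ‖y - pole θ q‖) := by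
  refine h.norm_pb_sub (ne_pole_of_norm_pos (h.norm_pos_of_far hx))
    (ne_pole_of_norm_pos (h.norm_pos_of_far hy)) (h.norm_mob_of_far hy) ?_
  refine norm_sub_lt_of_lt (h.norm_mob_sub_one_of_far hx) ?_
  rw [norm_sub_rev]
  exact h.norm_mob_sub_one_of_far hy

lemma one_far (h : IsPottsBethe θ q x₁ x₂ x₃ m) : ‖q‖ * ‖θ - 1‖ < ‖1 - pole θ q‖ := by
  rw [h.norm_one_sub_pole]
  exact h.rad_lt_eps.trans h.eps_lt_q

lemma pb_one (h : IsPottsBethe θ q x₁ x₂ x₃ m) : pb θ q 1 = 1 := by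
  have h1 : (1 : ℚ_[p]) - pole θ q ≠ 0 := norm_pos_iff.1 (h.norm_pos_of_far h.one_far)
  have : mob θ q 1 = 1 := by
    unfold mob
    rw [div_eq_one_iff_eq]
    · ring
    · convert h1 using 1
      unfold pole
      ring
  rw [pb_eq_mob_pow, this, one_pow]

lemma norm_pb_sub_one (h : IsPottsBethe θ q x₁ x₂ x₃ m)
    (hx : ‖q‖ * ‖θ - 1‖ < ‖x - pole θ q‖) :
    ‖pb θ q x - 1‖ = ‖θ - 1‖ * ‖x - 1‖ / ‖x - pole θ q‖ := by
  have h0 := h.norm_pos_of_far hx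
  have h1 := h.norm_pb_sub_of_far hx h.one_far
  rw [h.pb_one, h.norm_one_sub_pole] at h1
  rw [h1]
  have := h.q_pos
  field_simp

lemma norm_pb_sub_of_sphere (h : IsPottsBethe θ q x₁ x₂ x₃ m) (hx : ‖x - pole θ q‖ = ‖θ - 1‖)
    (hy : ‖y - pole θ q‖ = ‖θ - 1‖) :
    ‖pb θ q x - pb θ q y‖ = ‖q‖ / ‖θ - 1‖ * ‖x - y‖ := by
  rw [h.norm_pb_sub_of_far (by rw [hx]; exact h.rad_lt_eps) (by rw [hy]; exact h.rad_lt_eps),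
    hx, hy]
  have := h.eps_pos
  field_simp

/-- Outside the closed ball of centre `pole θ q` and radius `‖θ - 1‖`, the Potts–Bethe mapping
takes values close to its attracting fixed point. -/
lemma norm_pb_sub_one_lt (h : IsPottsBethe θ q x₁ x₂ x₃ m) (hx : ‖θ - 1‖ < ‖x - pole θ q‖) :
    ‖pb θ q x - 1‖ < ‖q‖ := by
  have h0 : 0 < ‖x - pole θ q‖ := h.eps_pos.trans hx
  rw [h.norm_pb_sub_one (h.rad_lt_eps.trans hx), div_lt_iff₀ h0]
  have h1 : ‖x - 1‖ ≤ max ‖x - pole θ q‖ ‖q‖ := by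
    rw [← h.norm_one_sub_pole, ← sub_sub_sub_cancel_right x 1 (pole θ q)]
    exact norm_sub_le_max _ _
  rcases le_max_iff.1 h1 with h2 | h2
  · calc ‖θ - 1‖ * ‖x - 1‖ ≤ ‖θ - 1‖ * ‖x - pole θ q‖ := by gcongr
      _ < ‖q‖ * ‖x - pole θ q‖ := mul_lt_mul_of_pos_right h.eps_lt_q h0
  · calc ‖θ - 1‖ * ‖x - 1‖ ≤ ‖θ - 1‖ * ‖q‖ := by gcongr
      _ < ‖q‖ * ‖x - pole θ q‖ := by rw [mul_comm]; exact mul_lt_mul_of_pos_left hx h.q_pos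

lemma dist_of_near_one (h : IsPottsBethe θ q x₁ x₂ x₃ m) (hx : ‖x - 1‖ < ‖q‖) :
    ‖x - pole θ q‖ = ‖q‖ := by
  rw [norm_sub_eq_of_lt (y := 1) (by rwa [h.norm_one_sub_pole]), h.norm_one_sub_pole]

lemma norm_pb_sub_one_of_near (h : IsPottsBethe θ q x₁ x₂ x₃ m) (hx : ‖x - 1‖ < ‖q‖) :
    ‖pb θ q x - 1‖ = ‖θ - 1‖ / ‖q‖ * ‖x - 1‖ := by
  rw [h.norm_pb_sub_one (by rw [h.dist_of_near_one hx]; exact h.rad_lt_eps.trans h.eps_lt_q),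
    h.dist_of_near_one hx]
  ring

lemma contraction_lt_one (h : IsPottsBethe θ q x₁ x₂ x₃ m) : ‖θ - 1‖ / ‖q‖ < 1 :=
  (div_lt_one h.q_pos).2 h.eps_lt_q

lemma contraction_pos (h : IsPottsBethe θ q x₁ x₂ x₃ m) : 0 < ‖θ - 1‖ / ‖q‖ :=
  div_pos h.eps_pos h.q_pos

/-- In this ball the distance to the pole is constantly |q|, so f contracts towards 1 by the factor
|θ-1|/|q|. -/
lemma mem_basin_of_near_one (h : IsPottsBethe θ q x₁ x₂ x₃ m) (hx : ‖x - 1‖ < ‖q‖) :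
    x ∈ basin (dom θ q) (pb θ q) 1 := by
  have key : ∀ n, ‖(pb θ q)^[n] x - 1‖ = (‖θ - 1‖ / ‖q‖) ^ n * ‖x - 1‖ ∧
      ‖(pb θ q)^[n] x - 1‖ < ‖q‖ := by
    intro n
    induction n with
    | zero => simpa using hx
    | succ n ih =>
      have h1 := h.norm_pb_sub_one_of_near ih.2
      rw [Function.iterate_succ_apply']
      refine ⟨by rw [h1, ih.1]; ring, ?_⟩
      rw [h1]
      exact (mul_le_of_le_one_left (norm_nonneg _) h.contraction_lt_one.le).trans_lt ih.2
  refine ⟨fun n => ?_, ?_⟩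
  · exact ne_pole_of_norm_pos (by rw [h.dist_of_near_one (key n).2]; exact h.q_pos)
  · rw [tendsto_iff_norm_sub_tendsto_zero]
    simp only [fun n => (key n).1]
    simpa using (tendsto_pow_atTop_nhds_zero_of_lt_one h.contraction_pos.le
      h.contraction_lt_one).mul_const ‖x - 1‖

lemma mem_basin_of_pb_mem {x₀ : ℚ_[p]} (hx : x ∈ dom θ q)
    (hfx : pb θ q x ∈ basin (dom θ q) (pb θ q) x₀) : x ∈ basin (dom θ q) (pb θ q) x₀ := by
  refine ⟨fun n => ?_, ?_⟩
  · rcases n with _ | n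
    · exact hx
    · exact hfx.1 n
  · rw [← tendsto_add_atTop_iff_nat 1]
    exact hfx.2

lemma mem_basin_of_iterate_mem {x₀ : ℚ_[p]} (n : ℕ) (hx : ∀ k < n, (pb θ q)^[k] x ∈ dom θ q)
    (hfx : (pb θ q)^[n] x ∈ basin (dom θ q) (pb θ q) x₀) :
    x ∈ basin (dom θ q) (pb θ q) x₀ := by
  induction n generalizing x with
  | zero => exact hfx
  | succ n ih =>
    exact mem_basin_of_pb_mem (hx 0 (by omega)) (ih (fun k hk => hx (k + 1) (by omega)) hfx)

lemma mem_basin_of_outside (h : IsPottsBethe θ q x₁ x₂ x₃ m) (hx : ‖θ - 1‖ < ‖x - pole θ q‖) :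
    x ∈ basin (dom θ q) (pb θ q) 1 :=
  mem_basin_of_pb_mem (ne_pole_of_norm_pos (h.eps_pos.trans hx))
    (h.mem_basin_of_near_one (h.norm_pb_sub_one_lt hx))

end Far

section Near

variable {x y z w : ℚ_[p]}

lemma norm_eq_one_of_near_pole (h : IsPottsBethe θ q x₁ x₂ x₃ m) (hx : ‖x - pole θ q‖ < 1) :
    ‖x‖ = 1 := by
  rw [← norm_one (α := ℚ_[p])]
  refine norm_eq_of_norm_sub_lt ?_
  rw [norm_one]
  refine norm_sub_lt_of_lt hx ?_
  rw [norm_sub_rev, h.norm_one_sub_pole]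
  exact h.q_lt_one

lemma norm_mob_of_fixed (h : IsPottsBethe θ q x₁ x₂ x₃ m) (hx : ‖x - pole θ q‖ < 1)
    (hfix : pb θ q x = x) : ‖mob θ q x‖ = 1 := by
  have h1 : ‖mob θ q x‖ ^ 3 = 1 := by
    rw [← norm_pow, ← pb_eq_mob_pow, hfix, h.norm_eq_one_of_near_pole hx]
  exact (pow_eq_one_iff_of_nonneg (norm_nonneg _) (by norm_num)).1 h1

lemma norm_mob_two (h : IsPottsBethe θ q x₁ x₂ x₃ m) : ‖mob θ q x₂‖ = 1 :=
  h.norm_mob_of_fixed (by rw [h.dist_two]; exact h.rad_lt_eps.trans h.eps_lt_one) h.fix_two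

lemma norm_mob_three (h : IsPottsBethe θ q x₁ x₂ x₃ m) : ‖mob θ q x₃‖ = 1 :=
  h.norm_mob_of_fixed (by rw [h.dist_three]; exact h.rad_lt_eps.trans h.eps_lt_one) h.fix_three

lemma dist_of_mem_ball (hx : ‖x - z‖ < ‖z - pole θ q‖) : ‖x - pole θ q‖ = ‖z - pole θ q‖ :=
  norm_sub_eq_of_lt hx

/-- On a ball that does not contain the pole and on whose centre the Möbius factor has norm one,
the Potts–Bethe mapping scales distances by a constant. -/
lemma norm_pb_sub_of_mem_ball (h : IsPottsBethe θ q x₁ x₂ x₃ m)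
    (hz : ‖q‖ * ‖θ - 1‖ ≤ ‖z - pole θ q‖) (hmz : ‖mob θ q z‖ = 1)
    (hx : ‖x - z‖ < ‖z - pole θ q‖) (hy : ‖y - z‖ < ‖z - pole θ q‖) :
    ‖pb θ q x - pb θ q y‖ = ‖q‖ * ‖θ - 1‖ / ‖z - pole θ q‖ ^ 2 * ‖x - y‖ := by
  have h0 : 0 < ‖z - pole θ q‖ := h.rad_pos.trans_le hz
  have hnear : ∀ {v}, ‖v - z‖ < ‖z - pole θ q‖ → ‖mob θ q v - mob θ q z‖ < 1 := by
    intro v hv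
    rw [h.norm_mob_sub (ne_pole_of_norm_pos (by rwa [dist_of_mem_ball hv]))
      (ne_pole_of_norm_pos h0), dist_of_mem_ball hv, div_lt_one (mul_pos h0 h0)]
    exact mul_lt_mul' hz hv (norm_nonneg _) h0
  have hmy : ‖mob θ q y‖ = 1 := by
    rw [← hmz]
    exact norm_eq_of_norm_sub_lt (by rw [hmz]; exact hnear hy)
  rw [h.norm_pb_sub (ne_pole_of_norm_pos (by rwa [dist_of_mem_ball hx]))
    (ne_pole_of_norm_pos (by rwa [dist_of_mem_ball hy])) hmy
    (norm_sub_lt_of_lt (hnear hx) (by rw [norm_sub_rev]; exact hnear hy)),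
    dist_of_mem_ball hx, dist_of_mem_ball hy]
  ring

lemma exists_mob_eq (h : IsPottsBethe θ q x₁ x₂ x₃ m) {g : ℚ_[p]} (hg : g ≠ θ) :
    ∃ x, x ≠ pole θ q ∧ mob θ q x = g := by
  have hs : (1 - θ - q) ≠ 0 := norm_pos_iff.1 (by rw [h.norm_aux]; exact h.q_pos)
  have he : θ - 1 ≠ 0 := norm_pos_iff.1 h.eps_pos
  have hg' : g - θ ≠ 0 := sub_ne_zero.2 hg
  have hx : pole θ q + (θ - 1) * (1 - θ - q) / (g - θ) ≠ pole θ q := by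
    simp [hs, he, hg']
  refine ⟨_, hx, ?_⟩
  rw [mob_eq hx, add_sub_cancel_left, div_div_cancel₀ (mul_ne_zero he hs)]
  ring

/-- One inclusion is the scaling law. For the other, w has a cube root near g(z) by Hensel, and
inverting the Möbius map gives x; comparing distances to θ shows that x and z are equally far from
the pole, so the scaling law bounds |x - z|. -/
lemma image_pb_ball (h : IsPottsBethe θ q x₁ x₂ x₃ m)
    (hz : ‖q‖ * ‖θ - 1‖ ≤ ‖z - pole θ q‖) (hmz : ‖mob θ q z‖ = 1) {ρ : ℝ}
    (hρ : ρ ≤ ‖z - pole θ q‖) : pb θ q '' Metric.ball z ρ =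
      Metric.ball (pb θ q z) (‖q‖ * ‖θ - 1‖ / ‖z - pole θ q‖ ^ 2 * ρ) := by
  have h0 : 0 < ‖z - pole θ q‖ := h.rad_pos.trans_le hz
  have hc : 0 < ‖q‖ * ‖θ - 1‖ / ‖z - pole θ q‖ ^ 2 := div_pos h.rad_pos (pow_pos h0 2)
  ext w
  simp only [Set.mem_image, Metric.mem_ball, dist_eq_norm]
  constructor
  · rintro ⟨x, hx, rfl⟩
    rw [h.norm_pb_sub_of_mem_ball hz hmz (hx.trans_le hρ) (by rwa [sub_self, norm_zero])]
    exact mul_lt_mul_of_pos_left hx hc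
  · intro hw
    have hw1 : ‖w - pb θ q z‖ < ‖q‖ * ‖θ - 1‖ / ‖z - pole θ q‖ := by
      refine hw.trans_le ?_
      calc _ ≤ ‖q‖ * ‖θ - 1‖ / ‖z - pole θ q‖ ^ 2 * ‖z - pole θ q‖ := by gcongr
        _ = _ := by field_simp
    have hle : ‖q‖ * ‖θ - 1‖ / ‖z - pole θ q‖ ≤ 1 := (div_le_one h0).2 hz
    obtain ⟨g, hg, hgz⟩ := exists_pow_eq_of_norm_lt_one (n := 3) (by exact_mod_cast h.norm_three)
      hmz (c := w) (by rw [← pb_eq_mob_pow]; exact hw1.trans_le hle)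
    have hgz' : ‖g - mob θ q z‖ = ‖w - pb θ q z‖ := by
      rw [← norm_cube_sub_cube h.norm_three hmz hgz, hg, pb_eq_mob_pow]
    have hgθ : ‖g - θ‖ = ‖q‖ * ‖θ - 1‖ / ‖z - pole θ q‖ := by
      rw [← h.norm_mob_sub_theta (ne_pole_of_norm_pos h0)] at hw1 ⊢
      exact norm_sub_eq_of_lt (by rwa [hgz'])
    obtain ⟨x, hx, rfl⟩ := h.exists_mob_eq (g := g)
      (sub_ne_zero.1 (norm_pos_iff.1 (by rw [hgθ]; exact div_pos h.rad_pos h0)))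
    have hxz : ‖x - pole θ q‖ = ‖z - pole θ q‖ := by
      have hx0 : 0 < ‖x - pole θ q‖ := norm_pos_iff.2 (sub_ne_zero.2 hx)
      rw [h.norm_mob_sub_theta hx, div_eq_div_iff hx0.ne' h0.ne'] at hgθ
      exact (mul_left_cancel₀ h.rad_pos.ne' hgθ).symm
    refine ⟨x, ?_, hg⟩
    rw [← hgz', h.norm_mob_sub hx (ne_pole_of_norm_pos h0), hxz] at hw
    rw [← mul_lt_mul_iff_right₀ hc]
    calc _ = ‖q‖ * ‖θ - 1‖ * ‖x - z‖ / (‖z - pole θ q‖ * ‖z - pole θ q‖) := by ring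
      _ < _ := hw

/-- A point of the closed ball of centre `pole θ q` and radius `‖θ - 1‖` that stays in it is
either on the bounding sphere or in one of the two balls around the second and third fixed
points. -/
lemma sphere_or_near_of_stay (h : IsPottsBethe θ q x₁ x₂ x₃ m) (hx : x ≠ pole θ q)
    (hx1 : ‖x - pole θ q‖ ≤ ‖θ - 1‖) (hx2 : ‖pb θ q x - pole θ q‖ ≤ ‖θ - 1‖) :
    ‖x - pole θ q‖ = ‖θ - 1‖ ∨ ‖x - x₂‖ < ‖q‖ * ‖θ - 1‖ ∨ ‖x - x₃‖ < ‖q‖ * ‖θ - 1‖ := by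
  have h0 : 0 < ‖x - pole θ q‖ := norm_pos_iff.2 (sub_ne_zero.2 hx)
  have hpb1 : ‖pb θ q x - 1‖ = ‖q‖ := by
    rw [norm_sub_eq_of_lt (y := pole θ q), norm_sub_rev, h.norm_one_sub_pole]
    rw [norm_sub_rev (pole θ q), h.norm_one_sub_pole]
    exact hx2.trans_lt h.eps_lt_q
  rcases lt_trichotomy ‖x - pole θ q‖ (‖q‖ * ‖θ - 1‖) with hlt | heq | hgt
  -- Strictly within r of the pole one has |g(x)| > 1, hence |f(x)| > 1, whereas points close to the
  -- pole have norm 1.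
  · exfalso
    have h1 : 1 < ‖mob θ q x - θ‖ := by
      rw [h.norm_mob_sub_theta hx]
      exact (one_lt_div h0).2 hlt
    have h2 : ‖mob θ q x‖ = ‖mob θ q x - θ‖ := by
      refine norm_eq_of_norm_sub_lt ?_
      rwa [sub_sub_cancel, h.norm_theta]
    have h3 : ‖pb θ q x‖ = 1 := h.norm_eq_one_of_near_pole (hx2.trans_lt h.eps_lt_one)
    rw [pb_eq_mob_pow, norm_pow, h2] at h3
    exact absurd h3 (one_lt_pow₀ h1 (by norm_num)).ne'
  · right
    set g := mob θ q x with hg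
    set g₂ := mob θ q x₂ with hg₂
    set g₃ := mob θ q x₃ with hg₃
    have hx₂ : x₂ ≠ pole θ q := ne_pole_of_norm_pos (by rw [h.dist_two]; exact h.rad_pos)
    have hx₃ : x₃ ≠ pole θ q := ne_pole_of_norm_pos (by rw [h.dist_three]; exact h.rad_pos)
    have hr := h.rad_pos
    have hg1 : ‖g - 1‖ = 1 := by
      have h1 : ‖g - θ‖ = 1 := by rw [h.norm_mob_sub_theta hx, heq, div_self hr.ne']
      rw [norm_sub_rev, norm_sub_eq_of_lt (y := θ), norm_sub_rev, h1]
      rw [norm_sub_rev 1 θ, norm_sub_rev θ g, h1]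
      exact h.eps_lt_one
    -- In (g-1)(g²+g+1) = f(x) - 1 the first factor is a unit and the right side has norm |q|, so g
    -- is a primitive cube root of unity modulo p.
    have hgg : ‖g ^ 2 + g + 1‖ < 1 := by
      have : ‖(g - 1) * (g ^ 2 + g + 1)‖ = ‖q‖ := by
        rw [← hpb1, pb_eq_mob_pow, ← hg]
        congr 1
        ring
      rw [norm_mul, hg1, one_mul] at this
      rw [this]
      exact h.q_lt_one
    have hsep : ‖g₂ - g₃‖ = 1 := by
      rw [h.norm_mob_sub hx₂ hx₃, h.separated, h.dist_two, h.dist_three,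
        div_self (mul_pos hr hr).ne']
    have hsum : ‖g₂ + g₃ + 1‖ < 1 := by
      have h1 : ‖(g₂ - g₃) * (g₂ + g₃ + 1)‖ < 1 := by
        rw [show (g₂ - g₃) * (g₂ + g₃ + 1) = (g₂ ^ 2 + g₂ + 1) - (g₃ ^ 2 + g₃ + 1) by ring]
        exact (norm_sub_le_max _ _).trans_lt (max_lt h.mob_two h.mob_three)
      rwa [norm_mul, hsep, one_mul] at h1
    -- Modulo p, g₂ and g₃ are the two distinct roots of X²+X+1, so g must be congruent to one of
    -- them.
    have hprod : ‖g - g₂‖ * ‖g - g₃‖ < 1 := by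
      rw [← norm_mul, show (g - g₂) * (g - g₃) = (g ^ 2 + g + 1) - (g₂ ^ 2 + g₂ + 1) -
        (g - g₂) * (g₂ + g₃ + 1) by ring]
      refine (norm_sub_le_max _ _).trans_lt (max_lt
        ((norm_sub_le_max _ _).trans_lt (max_lt hgg h.mob_two)) ?_)
      rw [norm_mul]
      refine (mul_le_of_le_one_left (norm_nonneg _) ?_).trans_lt hsum
      rw [h.norm_mob_sub hx hx₂, h.dist_two, heq, div_le_one (mul_pos hr hr)]
      refine mul_le_mul_of_nonneg_left ?_ hr.le
      refine norm_sub_le_of_le (y := pole θ q) heq.le ?_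
      rw [norm_sub_rev]
      exact h.dist_two.le
    have hsmall : ‖g - g₂‖ < 1 ∨ ‖g - g₃‖ < 1 := by
      by_contra! hcon
      exact absurd hprod (not_lt.2 (one_le_mul_of_one_le_of_one_le hcon.1 hcon.2))
    refine hsmall.imp (fun hs => ?_) fun hs => ?_
    · rw [h.norm_mob_sub hx hx₂, h.dist_two, heq, div_lt_one (mul_pos hr hr)] at hs
      exact lt_of_mul_lt_mul_left hs hr.le
    · rw [h.norm_mob_sub hx hx₃, h.dist_three, heq, div_lt_one (mul_pos hr hr)] at hs
      exact lt_of_mul_lt_mul_left hs hr.le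
  -- Strictly inside the sphere |x - 1| = |q|, so |f(x) - 1| = |θ-1||q|/|x - x^(∞)| would exceed
  -- |q|.
  · left
    by_contra hne
    have hlt : ‖x - pole θ q‖ < ‖θ - 1‖ := lt_of_le_of_ne hx1 hne
    have h1 : ‖x - 1‖ = ‖q‖ := by
      rw [norm_sub_eq_of_lt (y := pole θ q), norm_sub_rev, h.norm_one_sub_pole]
      rw [norm_sub_rev (pole θ q), h.norm_one_sub_pole]
      exact hlt.trans h.eps_lt_q
    rw [h.norm_pb_sub_one hgt, h1, div_eq_iff h0.ne', mul_comm] at hpb1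
    exact hne (mul_left_cancel₀ h.q_pos.ne' hpb1).symm

lemma norm_pb_sub_fix_one (h : IsPottsBethe θ q x₁ x₂ x₃ m) (hx : ‖x - pole θ q‖ = ‖θ - 1‖) :
    ‖pb θ q x - x₁‖ = ‖q‖ / ‖θ - 1‖ * ‖x - x₁‖ := by
  conv_lhs => rw [← h.fix_one]
  exact h.norm_pb_sub_of_sphere hx h.dist_one

lemma norm_sub_eq_contraction (h : IsPottsBethe θ q x₁ x₂ x₃ m) (hx : ‖x - pole θ q‖ = ‖θ - 1‖)
    (hy : ‖y - pole θ q‖ = ‖θ - 1‖) :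
    ‖x - y‖ = ‖θ - 1‖ / ‖q‖ * ‖pb θ q x - pb θ q y‖ := by
  rw [h.norm_pb_sub_of_sphere hx hy]
  have := h.eps_pos
  have := h.q_pos
  field_simp

end Near
end IsPottsBethe
end Map
end PottsBethe
namespace PottsBethe

/-! ### The fixed point cubic and its roots -/

section Roots

variable {p : ℕ} [Fact p.Prime]

lemma norm_mul_lt_one {x y : ℚ_[p]} (hx : ‖x‖ ≤ 1) (hy : ‖y‖ < 1) : ‖x * y‖ < 1 := by
  rw [norm_mul]
  exact (mul_le_of_le_one_left (norm_nonneg _) hx).trans_lt hy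

lemma three_lt_of_mod_three (hp : p ≡ 1 [MOD 3]) : 3 < p := by
  have h1 := (Fact.out : p.Prime).two_le
  have h2 : p % 3 = 1 := hp
  omega

lemma norm_two_eq_one (hp : 3 < p) : ‖(2 : ℚ_[p])‖ = 1 := by
  exact_mod_cast norm_natCast_eq_one_of_lt (p := p) (n := 2) (by norm_num) (by omega)

lemma norm_three_eq_one (hp : 3 < p) : ‖(3 : ℚ_[p])‖ = 1 := by
  exact_mod_cast norm_natCast_eq_one_of_lt (p := p) (n := 3) (by norm_num) hp

/-- If `p ≡ 1 mod 3` then `-3` is a square modulo `p`. -/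
lemma exists_norm_sq_add_three_lt (hp : p ≡ 1 [MOD 3]) : ∃ c : ℚ_[p], ‖c ^ 2 + 3‖ < 1 := by
  have h3 : Fact (Nat.Prime 3) := ⟨Nat.prime_three⟩
  have hdvd : 3 ∣ Fintype.card (ZMod p)ˣ := by
    rw [ZMod.card_units]
    exact (Nat.modEq_iff_dvd' (Fact.out : p.Prime).one_le).1 hp.symm
  obtain ⟨u, hu⟩ := exists_prime_orderOf_dvd_card 3 hdvd
  have hu3 : (u : ZMod p) ^ 3 = 1 := by
    have := pow_orderOf_eq_one u
    rw [hu] at this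
    rw [← Units.val_pow_eq_pow_val, this, Units.val_one]
  have hu1 : (u : ZMod p) - 1 ≠ 0 := by
    intro h
    have : u = 1 := Units.ext (sub_eq_zero.1 h)
    rw [this, orderOf_one] at hu
    norm_num at hu
  have hroot : (u : ZMod p) ^ 2 + u + 1 = 0 := by
    refine (mul_eq_zero.1 ?_).resolve_left hu1
    linear_combination hu3
  set n := (u : ZMod p).val with hn
  have hnu : ((n : ℕ) : ZMod p) = u := ZMod.natCast_zmod_val _
  have hpn : p ∣ n ^ 2 + n + 1 := by
    rw [← ZMod.natCast_eq_zero_iff]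
    push_cast
    rw [hnu, hroot]
  have h1 : ‖((n ^ 2 + n + 1 : ℕ) : ℚ_[p])‖ < 1 := (Padic.norm_natCast_lt_one_iff).2 hpn
  refine ⟨2 * n + 1, ?_⟩
  rw [show (2 * (n : ℚ_[p]) + 1) ^ 2 + 3 = ((4 : ℕ) : ℚ_[p]) * ((n ^ 2 + n + 1 : ℕ) : ℚ_[p]) by
    push_cast; ring]
  exact norm_mul_lt_one (by exact_mod_cast Padic.norm_int_le_one (p := p) 4) h1

open Polynomial in
/-- The large root of the fixed point cubic. -/
lemma exists_large_root (hp : 3 < p) {θ s : ℚ_[p]} (hθ : ‖θ - 1‖ < 1) (hs : ‖s‖ < 1) :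
    ∃ y : ℚ_[p], y ^ 3 - (1 + θ + θ ^ 2) * y ^ 2 - (2 * θ + 1) * s * y - s ^ 2 = 0 ∧
      ‖y - 3‖ < 1 := by
  obtain ⟨ε, rfl⟩ : ∃ ε : ℤ_[p], θ = ε + 1 := ⟨⟨θ - 1, hθ.le⟩, by simp⟩
  obtain ⟨s, rfl⟩ : ∃ s' : ℤ_[p], (s' : ℚ_[p]) = s := ⟨⟨s, hs.le⟩, rfl⟩
  rw [add_sub_cancel_right, ← PadicInt.norm_def, PadicInt.norm_lt_one_iff_dvd] at hθ
  rw [← PadicInt.norm_def, PadicInt.norm_lt_one_iff_dvd] at hs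
  obtain ⟨k, hk⟩ := hθ
  obtain ⟨l, hl⟩ := hs
  have h9 : ‖(9 : ℤ_[p])‖ = 1 := by
    rw [show (9 : ℤ_[p]) = ((9 : ℕ) : ℤ_[p]) by norm_num, PadicInt.norm_def, PadicInt.coe_natCast,
      show ((9 : ℕ) : ℚ_[p]) = 3 * 3 by norm_num, norm_mul, norm_three_eq_one hp, one_mul]
  -- At θ = 1, s = 0 the cubic is y³ - 3y², with simple root 3 and derivative 9 there.
  obtain ⟨z, hz, hz3⟩ := exists_root_of_norm_lt_one
    ((X : ℤ_[p][X]) ^ 3 - C (1 + (ε + 1) + (ε + 1) ^ 2) * X ^ 2 - C ((2 * (ε + 1) + 1) * s) * X -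
      C (s ^ 2)) 3
    (by
      rw [PadicInt.norm_lt_one_iff_dvd]
      simp only [eval_sub, eval_pow, eval_X, eval_mul, eval_C]
      rw [hk, hl]
      exact ⟨- 27 * k - 9 * k ^ 2 * p - 3 * (2 * (p * k + 1) + 1) * l - p * l ^ 2, by ring⟩)
    (by
      rw [← h9]
      refine norm_eq_of_norm_sub_lt ?_
      rw [h9, PadicInt.norm_lt_one_iff_dvd]
      simp only [derivative_sub, derivative_mul, derivative_C, derivative_X_pow, derivative_X,
        eval_sub, eval_pow, eval_X, eval_mul, eval_C, zero_mul, zero_add, mul_one,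
        eval_zero, map_natCast, eval_natCast]
      rw [hk, hl]
      exact ⟨- 18 * k - 6 * k ^ 2 * p - (2 * (p * k + 1) + 1) * l, by push_cast; ring⟩)
  simp only [eval_sub, eval_pow, eval_X, eval_mul, eval_C] at hz
  refine ⟨z, ?_, ?_⟩
  · have := congrArg (fun w : ℤ_[p] => (w : ℚ_[p])) hz
    push_cast at this
    exact this
  · rw [PadicInt.norm_def] at hz3
    exact_mod_cast hz3

/-- After removal of the large root y₁ ≡ 3, the substitution y = sw turns the remaining quadratic
into y₁w² + kw + 1 with k = s/y₁ + 2θ + 1 ≡ 3. Its discriminant is congruent to 9 - 12 = -3, a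
nonzero square modulo p because p ≡ 1 mod 3. -/
theorem exists_isRootTriple (hp : p ≡ 1 [MOD 3]) {θ q : ℚ_[p]} (hθ : ‖θ - 1‖ < 1)
    (hq : ‖q‖ < 1) : ∃ y₁ y₂ y₃ : ℚ_[p], IsRootTriple θ q y₁ y₂ y₃ := by
  have hp3 := three_lt_of_mod_three hp
  have h2 := norm_two_eq_one hp3
  have h3 := norm_three_eq_one hp3
  have hs : ‖1 - θ - q‖ < 1 := by
    refine (norm_sub_le_max _ _).trans_lt (max_lt ?_ hq)
    rwa [norm_sub_rev]
  obtain ⟨y₁, hy, hy3⟩ := exists_large_root hp3 hθ hs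
  set s := 1 - θ - q with hsdef
  have hy1 : ‖y₁‖ = 1 := by
    rw [← h3]
    exact norm_eq_of_norm_sub_lt (by rwa [h3])
  have hy0 : y₁ ≠ 0 := norm_pos_iff.1 (by rw [hy1]; exact one_pos)
  set k := s / y₁ + (2 * θ + 1) with hk
  have hk3 : ‖k - 3‖ < 1 := by
    rw [show k - 3 = s / y₁ + 2 * (θ - 1) by rw [hk]; ring]
    exact norm_add_lt_of_lt (by rwa [norm_div, hy1, div_one]) (norm_mul_lt_one h2.le hθ)
  have hk1 : ‖k‖ = 1 := by
    rw [← h3]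
    exact norm_eq_of_norm_sub_lt (by rwa [h3])
  obtain ⟨c, hc⟩ := exists_norm_sq_add_three_lt hp
  have hc1 : ‖c‖ = 1 := by
    have h1 : ‖c ^ 2‖ = 1 := by
      rw [← h3, ← norm_neg (3 : ℚ_[p])]
      refine norm_eq_of_norm_sub_lt ?_
      rwa [sub_neg_eq_add, norm_neg, h3]
    rw [norm_pow] at h1
    exact (pow_eq_one_iff_of_nonneg (norm_nonneg _) (by norm_num)).1 h1
  obtain ⟨δ, hδ, hδc⟩ := exists_pow_eq_of_norm_lt_one (n := 2) (by exact_mod_cast h2) hc1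
    (c := k ^ 2 - 4 * y₁) (by
      rw [show k ^ 2 - 4 * y₁ - c ^ 2 = (k + 3) * (k - 3) - 2 * (2 * (y₁ - 3)) - (c ^ 2 + 3) by
        ring]
      refine (norm_sub_le_max _ _).trans_lt (max_lt
        ((norm_sub_le_max _ _).trans_lt (max_lt (norm_mul_lt_one ?_ hk3)
          (norm_mul_lt_one h2.le (norm_mul_lt_one h2.le hy3)))) hc)
      exact (IsUltrametricDist.norm_add_le_max _ _).trans (max_le hk1.le h3.le))
  have hδ1 : ‖δ‖ = 1 := by
    rw [← hc1]
    exact norm_eq_of_norm_sub_lt (by rwa [hc1])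
  have hle1 : ‖-k + δ‖ ≤ 1 := (IsUltrametricDist.norm_add_le_max _ _).trans
    (max_le (by rw [norm_neg, hk1]) hδ1.le)
  have hle2 : ‖-k - δ‖ ≤ 1 := (norm_sub_le_max _ _).trans
    (max_le (by rw [norm_neg, hk1]) hδ1.le)
  -- Both factors are integral and their product 4y₁ is a unit, so both are units.
  have hprod : ‖-k + δ‖ * ‖-k - δ‖ = 1 := by
    rw [← norm_mul, show (-k + δ) * (-k - δ) = 2 * 2 * y₁ by linear_combination -hδ, norm_mul,
      norm_mul, h2, hy1]
    norm_num
  have he1 : ‖-k + δ‖ = 1 := by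
    refine le_antisymm hle1 ?_
    rw [← hprod]
    exact mul_le_of_le_one_right (norm_nonneg _) hle2
  have he2 : ‖-k - δ‖ = 1 := by rwa [he1, one_mul] at hprod
  have hsum : s * (-k + δ) / (2 * y₁) + s * (-k - δ) / (2 * y₁) = -(s * k / y₁) := by
    field_simp
    ring
  have hmul : s * (-k + δ) / (2 * y₁) * (s * (-k - δ) / (2 * y₁)) = s ^ 2 / y₁ := by
    field_simp
    linear_combination -s ^ 2 * hδ
  have hky : k * y₁ = s + (2 * θ + 1) * y₁ := by
    rw [hk]
    field_simp
  have hc1' : s * k / y₁ = y₁ - (1 + θ + θ ^ 2) := by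
    rw [div_eq_iff hy0]
    refine mul_right_cancel₀ hy0 ?_
    linear_combination s * hky - hy
  have hc2' : s ^ 2 / y₁ * y₁ = s ^ 2 := div_mul_cancel₀ _ hy0
  have hc3' : s * k / y₁ * y₁ = s * k := div_mul_cancel₀ _ hy0
  have hc4' : s ^ 2 / y₁ = s * k - (2 * θ + 1) * s := by
    rw [div_eq_iff hy0]
    linear_combination -s * hky
  refine ⟨y₁, s * (-k + δ) / (2 * y₁), s * (-k - δ) / (2 * y₁), fun y => ?_, hy1, ?_, ?_, hs⟩
  · rw [show (y - y₁) * (y - s * (-k + δ) / (2 * y₁)) * (y - s * (-k - δ) / (2 * y₁)) =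
      (y - y₁) * (y ^ 2 - (s * (-k + δ) / (2 * y₁) + s * (-k - δ) / (2 * y₁)) * y +
        s * (-k + δ) / (2 * y₁) * (s * (-k - δ) / (2 * y₁))) by ring, hsum, hmul]
    linear_combination -y ^ 2 * hc1' + y * hc3' - y * hc4' + hc2'
  · rw [norm_div, norm_mul, norm_mul, he1, h2, hy1, mul_one, mul_one, div_one]
  · rw [norm_div, norm_mul, norm_mul, he2, h2, hy1, mul_one, mul_one, div_one]

/-- Vieta's formulas, extracted from the factorization at 1, -1 and 0. -/
lemma IsRootTriple.sum_eq {θ q y₁ y₂ y₃ : ℚ_[p]} (h : IsRootTriple θ q y₁ y₂ y₃) :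
    y₁ + y₂ + y₃ = 1 + θ + θ ^ 2 := by
  linear_combination (1 / 2) * h.factor 1 + (1 / 2) * h.factor (-1) - h.factor 0

lemma IsRootTriple.sum_mul_eq {θ q y₁ y₂ y₃ : ℚ_[p]} (h : IsRootTriple θ q y₁ y₂ y₃) :
    y₁ * (y₂ + y₃) + y₂ * y₃ = -((2 * θ + 1) * (1 - θ - q)) := by
  linear_combination -(1 / 2) * h.factor 1 + (1 / 2) * h.factor (-1)

lemma IsRootTriple.mul_eq {θ q y₁ y₂ y₃ : ℚ_[p]} (h : IsRootTriple θ q y₁ y₂ y₃) :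
    y₁ * y₂ * y₃ = (1 - θ - q) ^ 2 := by
  linear_combination h.factor 0

lemma fixPt_sub_pole (θ q y : ℚ_[p]) : fixPt θ q y - pole θ q = (θ - 1) * y := by
  unfold fixPt pole
  ring

lemma mob_fixPt {θ q y : ℚ_[p]} (hε : θ - 1 ≠ 0) (hy : y ≠ 0) :
    mob θ q (fixPt θ q y) = θ + (1 - θ - q) / y := by
  have h1 : fixPt θ q y ≠ pole θ q := by
    rw [← sub_ne_zero, fixPt_sub_pole]
    exact mul_ne_zero hε hy
  rw [mob_eq h1, fixPt_sub_pole, mul_div_mul_left _ _ hε]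

/-- The origin of the cubic: x is fixed because g² + g + 1 = y and (g - 1)y = x - 1 multiply to g³ -
1 = x - 1. For the small roots it also shows that g is a primitive cube root of unity modulo p. -/
lemma mob_fixPt_sq_add {θ q y : ℚ_[p]} (hε : θ - 1 ≠ 0) (hy : y ≠ 0)
    (hroot : y ^ 3 - (1 + θ + θ ^ 2) * y ^ 2 - (2 * θ + 1) * (1 - θ - q) * y -
      (1 - θ - q) ^ 2 = 0) :
    mob θ q (fixPt θ q y) ^ 2 + mob θ q (fixPt θ q y) + 1 = y := by
  rw [mob_fixPt hε hy, ← sub_eq_zero]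
  field_simp
  linear_combination -hroot

lemma pb_fixPt {θ q y : ℚ_[p]} (hε : θ - 1 ≠ 0) (hy : y ≠ 0)
    (hroot : y ^ 3 - (1 + θ + θ ^ 2) * y ^ 2 - (2 * θ + 1) * (1 - θ - q) * y -
      (1 - θ - q) ^ 2 = 0) :
    pb θ q (fixPt θ q y) = fixPt θ q y := by
  have h1 := mob_fixPt_sq_add hε hy hroot
  have h2 : (mob θ q (fixPt θ q y) - 1) * y = fixPt θ q y - 1 := by
    rw [mob_fixPt hε hy]
    unfold fixPt
    field_simp
    ring
  rw [pb_eq_mob_pow]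
  linear_combination h2 + (mob θ q (fixPt θ q y) - 1) * h1

/-- The two small roots are separated by their common norm. -/
lemma IsRootTriple.norm_sub_eq (hp : 3 < p) {θ q y₁ y₂ y₃ : ℚ_[p]} (hθ : ‖θ - 1‖ < 1)
    (hs0 : 0 < ‖1 - θ - q‖) (h : IsRootTriple θ q y₁ y₂ y₃) :
    ‖y₂ - y₃‖ = ‖1 - θ - q‖ := by
  have h2 := norm_two_eq_one hp
  have h3 := norm_three_eq_one hp
  set s := 1 - θ - q with hs
  have hs1 : ‖s‖ < 1 := h.lt_one
  have hy3 : ‖y₁ - 3‖ < 1 := by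
    rw [show y₁ - 3 = (θ + 2) * (θ - 1) - y₂ - y₃ by linear_combination h.sum_eq]
    refine (norm_sub_le_max _ _).trans_lt (max_lt ((norm_sub_le_max _ _).trans_lt
      (max_lt (norm_mul_lt_one ?_ hθ) ?_)) ?_)
    · rw [show θ + 2 = θ - 1 + 3 by ring]
      exact (IsUltrametricDist.norm_add_le_max _ _).trans (max_le hθ.le h3.le)
    · rw [h.norm_two]; exact hs1
    · rw [h.norm_three]; exact hs1
  have hd : ‖(2 * θ + 1) ^ 2 - 4 * y₁‖ = 1 := by
    rw [← h3, ← norm_neg (3 : ℚ_[p])]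
    refine norm_eq_of_norm_sub_lt ?_
    rw [norm_neg, h3, show (2 * θ + 1) ^ 2 - 4 * y₁ - -3 =
      2 * (2 * ((θ + 2) * (θ - 1))) - 2 * (2 * (y₁ - 3)) by ring]
    refine (norm_sub_le_max _ _).trans_lt (max_lt (norm_mul_lt_one h2.le
      (norm_mul_lt_one h2.le (norm_mul_lt_one ?_ hθ)))
      (norm_mul_lt_one h2.le (norm_mul_lt_one h2.le hy3)))
    rw [show θ + 2 = θ - 1 + 3 by ring]
    exact (IsUltrametricDist.norm_add_le_max _ _).trans (max_le hθ.le h3.le)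
  have hθ1 : ‖2 * θ + 1‖ ≤ 1 := by
    rw [show 2 * θ + 1 = 2 * (θ - 1) + 3 by ring]
    exact (IsUltrametricDist.norm_add_le_max _ _).trans
      (max_le (norm_mul_lt_one h2.le hθ).le h3.le)
  have hyy : ‖y₂ * y₃‖ = ‖s‖ ^ 2 := by rw [norm_mul, h.norm_two, h.norm_three, sq]
  -- This is (y₁(y₂+y₃))² - 4y₁·y₁y₂y₃ rewritten by Vieta; the first term dominates since its second
  -- factor is congruent to -3.
  have key : (y₁ * (y₂ - y₃)) ^ 2 = s ^ 2 * ((2 * θ + 1) ^ 2 - 4 * y₁) +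
      y₂ * y₃ * (2 * ((2 * θ + 1) * s) + y₂ * y₃) := by
    have e1 := h.sum_mul_eq
    have e2 := h.mul_eq
    rw [← hs] at e1 e2
    have e3 : y₁ * (y₂ + y₃) = -((2 * θ + 1) * s) - y₂ * y₃ := by linear_combination e1
    linear_combination (y₁ * (y₂ + y₃) - ((2 * θ + 1) * s) - y₂ * y₃) * e3 - 4 * y₁ * e2
  have hmain : ‖(y₁ * (y₂ - y₃)) ^ 2‖ = ‖s‖ ^ 2 := by
    have h4 : ‖s ^ 2 * ((2 * θ + 1) ^ 2 - 4 * y₁)‖ = ‖s‖ ^ 2 := by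
      rw [norm_mul, hd, norm_pow, mul_one]
    rw [key, ← h4]
    refine norm_eq_of_norm_sub_lt ?_
    rw [add_sub_cancel_left, h4, norm_mul, hyy]
    refine mul_lt_of_lt_one_right (pow_pos hs0 2) (norm_add_lt_of_lt
      (norm_mul_lt_one h2.le (norm_mul_lt_one hθ1 hs1)) ?_)
    rw [hyy]
    exact pow_lt_one₀ (norm_nonneg _) hs1 (by norm_num)
  rw [norm_pow, norm_mul, h.norm_one, one_mul] at hmain
  exact (pow_left_inj₀ (norm_nonneg _) (norm_nonneg _) (by norm_num)).1 hmain

theorem IsRootTriple.isPottsBethe (hp : p ≡ 1 [MOD 3]) {θ q y₁ y₂ y₃ : ℚ_[p]} {m : ℕ}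
    (hm : 1 ≤ m) (hq0 : 0 < ‖q‖) (hq1 : ‖q‖ < 1) (hε : 0 < ‖θ - 1‖)
    (hlow : ‖q‖ ^ (m + 1) ≤ ‖θ - 1‖ ^ m) (hup : ‖θ - 1‖ ^ (m + 1) < ‖q‖ ^ (m + 2))
    (h : IsRootTriple θ q y₁ y₂ y₃) :
    IsPottsBethe θ q (fixPt θ q y₁) (fixPt θ q y₂) (fixPt θ q y₃) m := by
  have hp3 := three_lt_of_mod_three hp
  have heq : ‖θ - 1‖ < ‖q‖ := by
    by_contra! hle
    have h1 := pow_le_pow_left₀ hq0.le hle (m + 1)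
    have h2 := pow_lt_pow_right_of_lt_one₀ hq0 hq1 (show m + 1 < m + 2 by omega)
    linarith
  have hs : ‖1 - θ - q‖ = ‖q‖ := by
    rw [← norm_neg q]
    refine norm_eq_of_norm_sub_lt ?_
    rw [norm_neg, show 1 - θ - q - -q = -(θ - 1) by ring, norm_neg]
    exact heq
  have hε0 : θ - 1 ≠ 0 := norm_pos_iff.1 hε
  have hn2 : ‖y₂‖ = ‖q‖ := h.norm_two.trans hs
  have hn3 : ‖y₃‖ = ‖q‖ := h.norm_three.trans hs
  have hy1 : y₁ ≠ 0 := norm_pos_iff.1 (by rw [h.norm_one]; exact one_pos)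
  have hy2 : y₂ ≠ 0 := norm_pos_iff.1 (by rwa [hn2])
  have hy3 : y₃ ≠ 0 := norm_pos_iff.1 (by rwa [hn3])
  have r1 := (h.factor y₁).trans (by ring : _ = (0 : ℚ_[p]))
  have r2 := (h.factor y₂).trans (by ring : _ = (0 : ℚ_[p]))
  have r3 := (h.factor y₃).trans (by ring : _ = (0 : ℚ_[p]))
  refine ⟨hm, norm_three_eq_one hp3, hq0, hq1, hε, hlow, hup, ?_, ?_, ?_, pb_fixPt hε0 hy1 r1,
    pb_fixPt hε0 hy2 r2, pb_fixPt hε0 hy3 r3, ?_, ?_, ?_⟩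
  · rw [fixPt_sub_pole, norm_mul, h.norm_one, mul_one]
  · rw [fixPt_sub_pole, norm_mul, hn2, mul_comm]
  · rw [fixPt_sub_pole, norm_mul, hn3, mul_comm]
  · rwa [mob_fixPt_sq_add hε0 hy2 r2, hn2]
  · rwa [mob_fixPt_sq_add hε0 hy3 r3, hn3]
  · rw [show fixPt θ q y₂ - fixPt θ q y₃ = (y₂ - y₃) * (θ - 1) by unfold fixPt; ring, norm_mul,
      h.norm_sub_eq hp3 (heq.trans hq1) (by rwa [hs]), hs]

end Roots
end PottsBethe
-- The backward orbit of the pole, the sets ℋ_l and the global dynamics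
namespace PottsBethe

variable {p : ℕ} [Fact p.Prime]

/-- A backward orbit of the pole that converges to the fixed point `x₁`. -/
structure IsBackwardOrbit (θ q x₁ : ℚ_[p]) (b : ℕ → ℚ_[p]) : Prop where
  zero : b 0 = pole θ q
  map : ∀ l, pb θ q (b (l + 1)) = b l
  dist : ∀ l, ‖b l - x₁‖ = ‖θ - 1‖ * (‖θ - 1‖ / ‖q‖) ^ l

namespace IsPottsBethe

variable {θ q x₁ x₂ x₃ : ℚ_[p]} {m : ℕ} {x y : ℚ_[p]}

section Levels

lemma dist_pole_of_near_fix (h : IsPottsBethe θ q x₁ x₂ x₃ m) (hx : ‖x - x₁‖ < ‖θ - 1‖) :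
    ‖x - pole θ q‖ = ‖θ - 1‖ := by
  rw [← h.dist_one]
  exact norm_sub_eq_of_lt (by rwa [h.dist_one])

lemma level_succ_lt (h : IsPottsBethe θ q x₁ x₂ x₃ m) (l : ℕ) :
    ‖θ - 1‖ * (‖θ - 1‖ / ‖q‖) ^ (l + 1) < ‖θ - 1‖ :=
  mul_lt_of_lt_one_right h.eps_pos
    (pow_lt_one₀ h.contraction_pos.le h.contraction_lt_one (by omega))

lemma level_lt_level (h : IsPottsBethe θ q x₁ x₂ x₃ m) {k l : ℕ} (hkl : k < l) :
    ‖θ - 1‖ * (‖θ - 1‖ / ‖q‖) ^ l < ‖θ - 1‖ * (‖θ - 1‖ / ‖q‖) ^ k :=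
  mul_lt_mul_of_pos_left
    (pow_lt_pow_right_of_lt_one₀ h.contraction_pos h.contraction_lt_one hkl) h.eps_pos

/-- The lower bound on |θ-1| says (|θ-1|/|q|)^m ≥ |q|: up to index m, the b_l stay outside 𝒟₁. The
upper bound, used in `level_lt_rad`, puts b_(m+1) inside. -/
lemma rad_le_level (h : IsPottsBethe θ q x₁ x₂ x₃ m) {l : ℕ} (hl : l ≤ m) :
    ‖q‖ * ‖θ - 1‖ ≤ ‖θ - 1‖ * (‖θ - 1‖ / ‖q‖) ^ l := by
  rw [mul_comm]
  refine mul_le_mul_of_nonneg_left ?_ h.eps_pos.le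
  refine le_trans ?_ (pow_le_pow_of_le_one h.contraction_pos.le h.contraction_lt_one.le hl)
  rw [div_pow, le_div_iff₀ (pow_pos h.q_pos _), ← pow_succ']
  exact h.lower

lemma level_lt_rad (h : IsPottsBethe θ q x₁ x₂ x₃ m) :
    ‖θ - 1‖ * (‖θ - 1‖ / ‖q‖) ^ (m + 1) < ‖q‖ * ‖θ - 1‖ := by
  rw [mul_comm ‖q‖]
  refine mul_lt_mul_of_pos_left ?_ h.eps_pos
  rw [div_pow, div_lt_iff₀ (pow_pos h.q_pos _), ← pow_succ']
  exact h.upper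

lemma expansion_mul_level (h : IsPottsBethe θ q x₁ x₂ x₃ m) (l : ℕ) :
    ‖q‖ / ‖θ - 1‖ * (‖θ - 1‖ * (‖θ - 1‖ / ‖q‖) ^ (l + 1)) =
      ‖θ - 1‖ * (‖θ - 1‖ / ‖q‖) ^ l := by
  have := h.eps_pos
  have := h.q_pos
  rw [pow_succ]
  field_simp

lemma expansion_gt_one (h : IsPottsBethe θ q x₁ x₂ x₃ m) : 1 < ‖q‖ / ‖θ - 1‖ :=
  (one_lt_div h.eps_pos).2 h.eps_lt_q

lemma setG_eq (θ q x₁ : ℚ_[p]) (l : ℕ) :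
    setG θ q x₁ l = {z | ‖z - x₁‖ = ‖θ - 1‖ * (‖θ - 1‖ / ‖q‖) ^ l} := by
  unfold setG
  rw [div_pow, pow_succ', mul_div_assoc]

end Levels

lemma image_pb_ball_of_sphere (h : IsPottsBethe θ q x₁ x₂ x₃ m) (hx : ‖x - pole θ q‖ = ‖θ - 1‖)
    {ρ : ℝ} (hρ : ρ ≤ ‖θ - 1‖) :
    pb θ q '' Metric.ball x ρ = Metric.ball (pb θ q x) (‖q‖ / ‖θ - 1‖ * ρ) := by
  have h1 := h.rad_lt_eps
  rw [h.image_pb_ball (by rw [hx]; exact h1.le) (h.norm_mob_of_far (by rwa [hx]))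
    (by rwa [hx]), hx]
  have := h.eps_pos
  congr 1
  field_simp

/-- The open ball of radius |θ-1| about x₁ maps onto the one of radius |q| > |θ-1|. This inverse
branch can be iterated from the pole, which is at distance |θ-1| from x₁. -/
lemma exists_preimage_near_fix (h : IsPottsBethe θ q x₁ x₂ x₃ m) (hy : ‖y - x₁‖ ≤ ‖θ - 1‖) :
    ∃ x, pb θ q x = y ∧ ‖x - x₁‖ = ‖θ - 1‖ / ‖q‖ * ‖y - x₁‖ := by
  have h1 : y ∈ pb θ q '' Metric.ball x₁ ‖θ - 1‖ := by
    rw [h.image_pb_ball_of_sphere h.dist_one le_rfl, h.fix_one, Metric.mem_ball, dist_eq_norm]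
    refine hy.trans_lt ?_
    rw [div_mul_cancel₀ _ h.eps_pos.ne']
    exact h.eps_lt_q
  obtain ⟨x, hx, rfl⟩ := h1
  rw [Metric.mem_ball, dist_eq_norm] at hx
  refine ⟨x, rfl, ?_⟩
  conv_rhs => rw [← h.fix_one]
  rw [h.norm_sub_eq_contraction (h.dist_pole_of_near_fix hx) h.dist_one, h.fix_one]

lemma exists_isBackwardOrbit (h : IsPottsBethe θ q x₁ x₂ x₃ m) :
    ∃ b, IsBackwardOrbit θ q x₁ b := by
  choose! φ hφ1 hφ2 using fun y => h.exists_preimage_near_fix (y := y)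
  have key : ∀ l, ‖φ^[l] (pole θ q) - x₁‖ = ‖θ - 1‖ * (‖θ - 1‖ / ‖q‖) ^ l ∧
      ‖φ^[l] (pole θ q) - x₁‖ ≤ ‖θ - 1‖ := by
    intro l
    induction l with
    | zero => simp [norm_sub_rev, h.dist_one]
    | succ l ih =>
      have h1 : ‖φ^[l + 1] (pole θ q) - x₁‖ = ‖θ - 1‖ * (‖θ - 1‖ / ‖q‖) ^ (l + 1) := by
        rw [Function.iterate_succ_apply', hφ2 _ ih.2, ih.1]
        ring
      exact ⟨h1, h1.trans_le (h.level_succ_lt l).le⟩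
  refine ⟨fun l => φ^[l] (pole θ q), rfl, fun l => ?_, fun l => (key l).1⟩
  simp only [Function.iterate_succ_apply']
  exact hφ1 _ (key l).2

section Sphere

lemma dist_pole_of_level (h : IsPottsBethe θ q x₁ x₂ x₃ m) {l : ℕ}
    (hx : ‖x - x₁‖ = ‖θ - 1‖ * (‖θ - 1‖ / ‖q‖) ^ (l + 1)) : ‖x - pole θ q‖ = ‖θ - 1‖ :=
  h.dist_pole_of_near_fix (hx.trans_lt (h.level_succ_lt l))

lemma level_pb (h : IsPottsBethe θ q x₁ x₂ x₃ m) {l : ℕ}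
    (hx : ‖x - x₁‖ = ‖θ - 1‖ * (‖θ - 1‖ / ‖q‖) ^ (l + 1)) :
    ‖pb θ q x - x₁‖ = ‖θ - 1‖ * (‖θ - 1‖ / ‖q‖) ^ l := by
  rw [h.norm_pb_sub_fix_one (h.dist_pole_of_level hx), hx, h.expansion_mul_level]

lemma mem_iterDom_of_level (h : IsPottsBethe θ q x₁ x₂ x₃ m) (l : ℕ)
    (hx : ‖x - x₁‖ = ‖θ - 1‖ * (‖θ - 1‖ / ‖q‖) ^ l) : x ∈ iterDom (dom θ q) (pb θ q) l := by
  induction l generalizing x with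
  | zero => exact fun k hk => absurd hk (by omega)
  | succ l ih =>
    intro k hk
    rcases k with _ | k
    · exact ne_pole_of_norm_pos (x := x) (by rw [h.dist_pole_of_level hx]; exact h.eps_pos)
    · exact ih (h.level_pb hx) k (by omega)

/-- A point of level l descends one level per step and stays at distance |θ-1| from the pole for its
first l positions, so f^l is a composition of l similarities of ratio |q|/|θ-1|. -/
lemma iterate_image_ball (h : IsPottsBethe θ q x₁ x₂ x₃ m) (l : ℕ)
    (hx : ‖x - x₁‖ = ‖θ - 1‖ * (‖θ - 1‖ / ‖q‖) ^ l) {ρ : ℝ}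
    (hρ : ρ ≤ ‖θ - 1‖ * (‖θ - 1‖ / ‖q‖) ^ l) :
    (pb θ q)^[l] '' Metric.ball x ρ =
      Metric.ball ((pb θ q)^[l] x) ((‖q‖ / ‖θ - 1‖) ^ l * ρ) := by
  induction l generalizing x ρ with
  | zero => simp
  | succ l ih =>
    rw [Function.iterate_succ, Set.image_comp,
      h.image_pb_ball_of_sphere (h.dist_pole_of_level hx) (hρ.trans (h.level_succ_lt l).le),
      ih (h.level_pb hx)]
    · rw [Function.comp_apply, pow_succ, mul_assoc]
    · rw [← h.expansion_mul_level]
      exact mul_le_mul_of_nonneg_left hρ (by positivity)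

lemma norm_iterate_sub_of_level (h : IsPottsBethe θ q x₁ x₂ x₃ m) (l : ℕ)
    (hx : ‖x - x₁‖ = ‖θ - 1‖ * (‖θ - 1‖ / ‖q‖) ^ l)
    (hy : ‖y - x₁‖ = ‖θ - 1‖ * (‖θ - 1‖ / ‖q‖) ^ l) :
    ‖(pb θ q)^[l] x - (pb θ q)^[l] y‖ = (‖q‖ / ‖θ - 1‖) ^ l * ‖x - y‖ := by
  induction l generalizing x y with
  | zero => simp
  | succ l ih =>
    rw [Function.iterate_succ_apply, Function.iterate_succ_apply,
      ih (h.level_pb hx) (h.level_pb hy),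
      h.norm_pb_sub_of_sphere (h.dist_pole_of_level hx) (h.dist_pole_of_level hy)]
    ring

lemma imageIter_ball (h : IsPottsBethe θ q x₁ x₂ x₃ m) (l : ℕ)
    (hx : ‖x - x₁‖ = ‖θ - 1‖ * (‖θ - 1‖ / ‖q‖) ^ l) {ρ : ℝ}
    (hρ : ρ ≤ ‖θ - 1‖ * (‖θ - 1‖ / ‖q‖) ^ l) :
    imageIter (dom θ q) (pb θ q) l (Metric.ball x ρ) =
      Metric.ball ((pb θ q)^[l] x) ((‖q‖ / ‖θ - 1‖) ^ l * ρ) := by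
  rw [← h.iterate_image_ball l hx hρ]
  ext w
  constructor
  · rintro ⟨v, hv, -, rfl⟩
    exact ⟨v, hv, rfl⟩
  · rintro ⟨v, hv, rfl⟩
    refine ⟨v, hv, h.mem_iterDom_of_level l ?_, rfl⟩
    rw [Metric.mem_ball, dist_eq_norm] at hv
    rw [← hx]
    exact norm_sub_eq_of_lt (hv.trans_le (hx ▸ hρ))

end Sphere

end IsPottsBethe

namespace IsBackwardOrbit

variable {θ q x₁ : ℚ_[p]} {b : ℕ → ℚ_[p]}

lemma iterate_eq (hb : IsBackwardOrbit θ q x₁ b) (l : ℕ) : (pb θ q)^[l] (b l) = pole θ q := by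
  induction l with
  | zero => exact hb.zero
  | succ l ih => rw [Function.iterate_succ_apply, hb.map, ih]

end IsBackwardOrbit

namespace IsPottsBethe

variable {θ q x₁ x₂ x₃ : ℚ_[p]} {m : ℕ} {x y : ℚ_[p]} {b : ℕ → ℚ_[p]}

lemma setC_eq_ball (hx : ‖x - pole θ q‖ = ‖q‖ * ‖θ - 1‖) :
    setC θ q x = Metric.ball x (‖q‖ * ‖θ - 1‖) := by
  ext z
  simp only [setC, Set.mem_ofPred_eq, Metric.mem_ball, dist_eq_norm]
  constructor
  · rintro ⟨h1, h2⟩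
    rwa [h2] at h1
  · intro hz
    have h1 : ‖z - pole θ q‖ = ‖q‖ * ‖θ - 1‖ := by
      rw [← hx]
      exact norm_sub_eq_of_lt (by rwa [hx])
    exact ⟨by rwa [h1], h1⟩

/-- The image under f^l of a ball of radius r in 𝒢_l is a ball of radius greater than r. It contains
𝒞₂ ∪ 𝒞₃ exactly when it contains the pole f^l(b_l), which is at distance r from x₂ and x₃; that
happens only for the ball around b_l. -/
lemma setH_eq_ball (h : IsPottsBethe θ q x₁ x₂ x₃ m) (hb : IsBackwardOrbit θ q x₁ b) {l : ℕ}
    (hl : 1 ≤ l) (hlm : l ≤ m) :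
    setH θ q x₁ x₂ x₃ l = Metric.ball (b l) (‖q‖ * ‖θ - 1‖) := by
  have hr := h.rad_pos
  have hρ := h.rad_le_level hlm
  have hc : 1 < (‖q‖ / ‖θ - 1‖) ^ l := one_lt_pow₀ h.expansion_gt_one (by omega)
  have hR : ‖q‖ * ‖θ - 1‖ < (‖q‖ / ‖θ - 1‖) ^ l * (‖q‖ * ‖θ - 1‖) :=
    lt_mul_of_one_lt_left hr hc
  unfold setH rad
  rw [setG_eq, setC_eq_ball h.dist_two, setC_eq_ball h.dist_three]
  ext z
  simp only [Set.mem_iUnion, exists_prop]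
  constructor
  · rintro ⟨c, ⟨hcG, hcC⟩, hz⟩
    have hcl : ‖c - x₁‖ = ‖θ - 1‖ * (‖θ - 1‖ / ‖q‖) ^ l := hcG (Metric.mem_ball_self hr)
    rw [h.imageIter_ball l hcl hρ] at hcC
    have h2 := hcC (Or.inl (Metric.mem_ball_self hr))
    rw [Metric.mem_ball, dist_eq_norm, norm_sub_rev] at h2
    have h3 : ‖(pb θ q)^[l] c - pole θ q‖ < (‖q‖ / ‖θ - 1‖) ^ l * (‖q‖ * ‖θ - 1‖) :=
      norm_sub_lt_of_lt h2 (by rwa [h.dist_two])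
    rw [← hb.iterate_eq l, h.norm_iterate_sub_of_level l hcl (hb.dist l),
      mul_lt_mul_iff_right₀ (one_pos.trans hc)] at h3
    have h4 : c ∈ Metric.ball (b l) (‖q‖ * ‖θ - 1‖) := by rwa [Metric.mem_ball, dist_eq_norm]
    rwa [IsUltrametricDist.ball_eq_of_mem h4]
  · intro hz
    refine ⟨b l, ⟨fun v hv => ?_, ?_⟩, hz⟩
    · rw [Metric.mem_ball, dist_eq_norm] at hv
      rw [Set.mem_ofPred_eq, ← hb.dist l]
      exact norm_sub_eq_of_lt (hv.trans_le (by rwa [hb.dist l]))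
    · rw [h.imageIter_ball l (hb.dist l) hρ, hb.iterate_eq]
      rintro v (hv | hv) <;> rw [Metric.mem_ball, dist_eq_norm] at hv ⊢
      · exact norm_sub_lt_of_lt (hv.trans hR) (by rwa [h.dist_two])
      · exact norm_sub_lt_of_lt (hv.trans hR) (by rwa [h.dist_three])

lemma mem_setX_iff (h : IsPottsBethe θ q x₁ x₂ x₃ m) (hb : IsBackwardOrbit θ q x₁ b) :
    x ∈ setX θ q x₁ x₂ x₃ m ↔ ‖x - x₁‖ < ‖q‖ * ‖θ - 1‖ ∨
      (∃ l, 1 ≤ l ∧ l ≤ m ∧ ‖x - b l‖ < ‖q‖ * ‖θ - 1‖) ∨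
      ‖x - x₂‖ < ‖q‖ * ‖θ - 1‖ ∨ ‖x - x₃‖ < ‖q‖ * ‖θ - 1‖ := by
  unfold setX rad
  rw [setC_eq_ball h.dist_two, setC_eq_ball h.dist_three]
  simp only [Set.mem_union, Metric.mem_ball, dist_eq_norm, Set.mem_iUnion, Finset.mem_Icc,
    exists_prop, or_assoc]
  have : (∃ l, (1 ≤ l ∧ l ≤ m) ∧ x ∈ setH θ q x₁ x₂ x₃ l) ↔
      ∃ l, 1 ≤ l ∧ l ≤ m ∧ ‖x - b l‖ < ‖q‖ * ‖θ - 1‖ := by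
    refine exists_congr fun l => ⟨fun ⟨⟨h1, h2⟩, h3⟩ => ⟨h1, h2, ?_⟩,
      fun ⟨h1, h2, h3⟩ => ⟨⟨h1, h2⟩, ?_⟩⟩
    · rwa [h.setH_eq_ball hb h1 h2, Metric.mem_ball, dist_eq_norm] at h3
    · rwa [h.setH_eq_ball hb h1 h2, Metric.mem_ball, dist_eq_norm]
  rw [this]

section BackwardOrbit

variable {l : ℕ}

lemma dist_orbit_pole (h : IsPottsBethe θ q x₁ x₂ x₃ m) (hb : IsBackwardOrbit θ q x₁ b)
    (hl : 1 ≤ l) : ‖b l - pole θ q‖ = ‖θ - 1‖ := by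
  obtain ⟨l, rfl⟩ := Nat.exists_eq_add_of_le' hl
  exact h.dist_pole_of_level (hb.dist (l + 1))

lemma dist_orbit_orbit (h : IsPottsBethe θ q x₁ x₂ x₃ m) (hb : IsBackwardOrbit θ q x₁ b) {k : ℕ}
    (hkl : k < l) : ‖b k - b l‖ = ‖θ - 1‖ * (‖θ - 1‖ / ‖q‖) ^ k := by
  rw [← hb.dist k, norm_sub_rev, norm_sub_rev _ x₁]
  refine norm_sub_eq_of_lt ?_
  rw [norm_sub_rev x₁, hb.dist, hb.dist]
  exact h.level_lt_level hkl

lemma dist_orbit_small (h : IsPottsBethe θ q x₁ x₂ x₃ m) (hb : IsBackwardOrbit θ q x₁ b)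
    (hl : 1 ≤ l) (hx : ‖x - pole θ q‖ = ‖q‖ * ‖θ - 1‖) : ‖x - b l‖ = ‖θ - 1‖ := by
  rw [← h.dist_orbit_pole hb hl, norm_sub_rev (b l)]
  refine norm_sub_eq_of_lt ?_
  rw [norm_sub_rev _ (b l), h.dist_orbit_pole hb hl, hx]
  exact h.rad_lt_eps

lemma dist_fix_small (h : IsPottsBethe θ q x₁ x₂ x₃ m)
    (hx : ‖x - pole θ q‖ = ‖q‖ * ‖θ - 1‖) : ‖x - x₁‖ = ‖θ - 1‖ := by
  rw [← h.dist_one, norm_sub_rev x₁]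
  refine norm_sub_eq_of_lt ?_
  rw [norm_sub_rev _ x₁, h.dist_one, hx]
  exact h.rad_lt_eps

end BackwardOrbit

lemma dist_pole_of_mem_setX (h : IsPottsBethe θ q x₁ x₂ x₃ m) (hb : IsBackwardOrbit θ q x₁ b)
    (hx : x ∈ setX θ q x₁ x₂ x₃ m) : 0 < ‖x - pole θ q‖ ∧ ‖x - pole θ q‖ ≤ ‖θ - 1‖ := by
  have key : ∀ c, ‖c - pole θ q‖ = ‖θ - 1‖ ∨ ‖c - pole θ q‖ = ‖q‖ * ‖θ - 1‖ →
      ‖x - c‖ < ‖q‖ * ‖θ - 1‖ → 0 < ‖x - pole θ q‖ ∧ ‖x - pole θ q‖ ≤ ‖θ - 1‖ := by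
    intro c hc hxc
    have hr := h.rad_lt_eps
    have h1 : ‖x - pole θ q‖ = ‖c - pole θ q‖ :=
      norm_sub_eq_of_lt (hxc.trans_le (by rcases hc with hc | hc <;> rw [hc]; exact hr.le))
    rw [h1]
    rcases hc with hc | hc <;> rw [hc]
    · exact ⟨h.eps_pos, le_rfl⟩
    · exact ⟨h.rad_pos, hr.le⟩
  rcases (h.mem_setX_iff hb).1 hx with h1 | ⟨l, hl, -, h1⟩ | h1 | h1
  · exact key x₁ (Or.inl h.dist_one) h1
  · exact key (b l) (Or.inl (h.dist_orbit_pole hb hl)) h1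
  · exact key x₂ (Or.inr h.dist_two) h1
  · exact key x₃ (Or.inr h.dist_three) h1

lemma setX_subset_dom (h : IsPottsBethe θ q x₁ x₂ x₃ m) (hb : IsBackwardOrbit θ q x₁ b) :
    setX θ q x₁ x₂ x₃ m ⊆ dom θ q :=
  fun _ hx => ne_pole_of_norm_pos (h.dist_pole_of_mem_setX hb hx).1

lemma mem_setX_of_pb_mem (h : IsPottsBethe θ q x₁ x₂ x₃ m) (hb : IsBackwardOrbit θ q x₁ b)
    (hx : x ∈ dom θ q) (hfx : pb θ q x ∈ setX θ q x₁ x₂ x₃ m) : x ∈ setX θ q x₁ x₂ x₃ m := by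
  have hfd := (h.dist_pole_of_mem_setX hb hfx).2
  have hxd : ‖x - pole θ q‖ ≤ ‖θ - 1‖ := by
    by_contra! hlt
    have h1 := h.norm_pb_sub_one_lt hlt
    have h2 := h.dist_of_near_one h1
    exact absurd hfd (not_le.2 (h2 ▸ h.eps_lt_q))
  rcases h.sphere_or_near_of_stay hx hxd hfd with hs | hC
  swap
  · exact (h.mem_setX_iff hb).2 (Or.inr (Or.inr hC))
  -- Inverse branches on the sphere contract strictly, so the closed inequality becomes strict. This
  -- is needed for 𝒞₂ and 𝒞₃, whose points are at distance exactly r from the pole f(b 1).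
  have hpull : ∀ {y}, ‖y - pole θ q‖ = ‖θ - 1‖ → ‖pb θ q x - pb θ q y‖ ≤ ‖q‖ * ‖θ - 1‖ →
      ‖x - y‖ < ‖q‖ * ‖θ - 1‖ := by
    intro y hy hlt
    rw [h.norm_sub_eq_contraction hs hy]
    calc _ ≤ ‖θ - 1‖ / ‖q‖ * (‖q‖ * ‖θ - 1‖) :=
          mul_le_mul_of_nonneg_left hlt h.contraction_pos.le
      _ < ‖q‖ * ‖θ - 1‖ := mul_lt_of_lt_one_left h.rad_pos h.contraction_lt_one
  have hsmall : ∀ c, ‖c - pole θ q‖ = ‖q‖ * ‖θ - 1‖ → ‖pb θ q x - c‖ < ‖q‖ * ‖θ - 1‖ →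
      x ∈ setX θ q x₁ x₂ x₃ m := by
    intro c hc hlt
    refine (h.mem_setX_iff hb).2 (Or.inr (Or.inl ⟨1, le_rfl, h.one_le, ?_⟩))
    refine hpull (h.dist_orbit_pole hb le_rfl) ?_
    rw [hb.map 0, hb.zero]
    exact norm_sub_le_of_le hlt.le hc.le
  rcases (h.mem_setX_iff hb).1 hfx with h1 | ⟨l, hl, hlm, h1⟩ | h1 | h1
  · refine (h.mem_setX_iff hb).2 (Or.inl (hpull h.dist_one ?_))
    rw [h.fix_one]
    exact h1.le
  · have h2 : ‖x - b (l + 1)‖ < ‖q‖ * ‖θ - 1‖ := by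
      refine hpull (h.dist_orbit_pole hb (by omega)) ?_
      rw [hb.map]
      exact h1.le
    rcases Nat.lt_or_ge l m with hlt | hge
    · exact (h.mem_setX_iff hb).2 (Or.inr (Or.inl ⟨l + 1, by omega, hlt, h2⟩))
    -- A preimage of ℋ_m on the sphere lies near b_(m+1), hence in 𝒟₁.
    · obtain rfl : l = m := le_antisymm hlm hge
      refine (h.mem_setX_iff hb).2 (Or.inl (norm_sub_lt_of_lt h2 ?_))
      rw [hb.dist]
      exact h.level_lt_rad
  · exact hsmall x₂ h.dist_two h1
  · exact hsmall x₃ h.dist_three h1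

lemma mem_setX_of_iterate_mem (h : IsPottsBethe θ q x₁ x₂ x₃ m) (hb : IsBackwardOrbit θ q x₁ b)
    (n : ℕ) (hx : ∀ k < n, (pb θ q)^[k] x ∈ dom θ q)
    (hfx : (pb θ q)^[n] x ∈ setX θ q x₁ x₂ x₃ m) : x ∈ setX θ q x₁ x₂ x₃ m := by
  induction n generalizing x with
  | zero => exact hfx
  | succ n ih =>
    exact h.mem_setX_of_pb_mem hb (hx 0 (by omega)) (ih (fun k hk => hx (k + 1) (by omega)) hfx)

/-- An orbit that meets 𝒞₂ ∪ 𝒞₃ starts in X_m by backward invariance. Otherwise it stays on the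
sphere, where the distance to x₁ grows geometrically yet remains bounded, so the starting point is
x₁ itself. -/
lemma mem_setX_of_stay (h : IsPottsBethe θ q x₁ x₂ x₃ m) (hb : IsBackwardOrbit θ q x₁ b)
    (hx : ∀ n, (pb θ q)^[n] x ∈ dom θ q)
    (hstay : ∀ n, ‖(pb θ q)^[n] x - pole θ q‖ ≤ ‖θ - 1‖) : x ∈ setX θ q x₁ x₂ x₃ m := by
  by_cases hC : ∃ n, ‖(pb θ q)^[n] x - x₂‖ < ‖q‖ * ‖θ - 1‖ ∨
      ‖(pb θ q)^[n] x - x₃‖ < ‖q‖ * ‖θ - 1‖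
  · obtain ⟨n, hn⟩ := hC
    exact h.mem_setX_of_iterate_mem hb n (fun k _ => hx k)
      ((h.mem_setX_iff hb).2 (Or.inr (Or.inr hn)))
  · have hsph : ∀ n, ‖(pb θ q)^[n] x - pole θ q‖ = ‖θ - 1‖ := fun n =>
      (h.sphere_or_near_of_stay (hx n) (hstay n)
        (by rw [← Function.iterate_succ_apply' (pb θ q)]; exact hstay (n + 1))).resolve_right
        fun hn => hC ⟨n, hn⟩
    have hgrow : ∀ n, ‖(pb θ q)^[n] x - x₁‖ = (‖q‖ / ‖θ - 1‖) ^ n * ‖x - x₁‖ := by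
      intro n
      induction n with
      | zero => simp
      | succ n ih =>
        rw [Function.iterate_succ_apply', h.norm_pb_sub_fix_one (hsph n), ih]
        ring
    have hx1 : ‖x - x₁‖ = 0 := by
      by_contra hne
      have hpos : 0 < ‖x - x₁‖ := lt_of_le_of_ne (norm_nonneg _) (Ne.symm hne)
      obtain ⟨n, hn⟩ := pow_unbounded_of_one_lt (‖θ - 1‖ / ‖x - x₁‖) h.expansion_gt_one
      rw [div_lt_iff₀ hpos, ← hgrow n] at hn
      refine absurd hn (not_lt.2 (norm_sub_le_of_le (hstay n) ?_))
      rw [norm_sub_rev]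
      exact h.dist_one.le
    exact (h.mem_setX_iff hb).2 (Or.inl (hx1 ▸ h.rad_pos))

/-- Every point is attracted by `1`, or has its orbit in `setX`, or is mapped to the pole. -/
theorem univ_eq (h : IsPottsBethe θ q x₁ x₂ x₃ m) (hb : IsBackwardOrbit θ q x₁ b) :
    (Set.univ : Set ℚ_[p]) = basin (dom θ q) (pb θ q) 1 ∪
      juliaSet (dom θ q) (pb θ q) (setX θ q x₁ x₂ x₃ m) ∪
        ⋃ n : ℕ, preimageIter (dom θ q) (pb θ q) n {pole θ q} := by
  refine (Set.eq_univ_of_forall fun x => ?_).symm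
  by_cases hd : ∀ n, (pb θ q)^[n] x ∈ dom θ q
  · left
    by_cases hs : ∀ n, ‖(pb θ q)^[n] x - pole θ q‖ ≤ ‖θ - 1‖
    · right
      refine (mem_juliaSet_iff (h.setX_subset_dom hb)).2 fun n => h.mem_setX_of_stay hb ?_ ?_
      · intro k
        rw [← Function.iterate_add_apply]
        exact hd _
      · intro k
        rw [← Function.iterate_add_apply]
        exact hs _
    · push Not at hs
      obtain ⟨n, hn⟩ := hs
      left
      exact mem_basin_of_iterate_mem n (fun k _ => hd k) (h.mem_basin_of_outside hn)
  · right
    push Not at hd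
    classical
    -- The first exit from the domain is the arrival at the pole.
    refine Set.mem_iUnion.2 ⟨Nat.find hd, fun k hk => not_not.1 (Nat.find_min hd hk), ?_⟩
    exact not_not.1 (Nat.find_spec hd)

end IsPottsBethe
end PottsBethe
-- Centres, exponents and the incidence matrix
namespace PottsBethe

variable {p : ℕ} [Fact p.Prime]

/-- The centres of the balls of the decomposition of `setX`, in the order of the coding. -/
def center {α : Type*} (m : ℕ) (x₁ x₂ x₃ : α) (b : ℕ → α) (i : Fin (m + 3)) : α :=
  if (i : ℕ) = 0 then x₁ else if (i : ℕ) ≤ m then b (m + 1 - i)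
  else if (i : ℕ) = m + 1 then x₂ else x₃

/-- The scaling exponents of the Potts–Bethe mapping on the balls of the decomposition. -/
noncomputable def exponent (θ q : ℚ_[p]) (m : ℕ) (i : Fin (m + 3)) : ℤ :=
  if (i : ℕ) ≤ m then (θ - 1).valuation - q.valuation else (θ - 1).valuation + q.valuation

section Index

variable {α : Type*} {m : ℕ} {x₁ x₂ x₃ : α} {b : ℕ → α} {i : Fin (m + 3)}

lemma index_cases (i : Fin (m + 3)) : (i : ℕ) = 0 ∨
    (∃ l, 1 ≤ l ∧ l ≤ m ∧ (i : ℕ) + l = m + 1) ∨ (i : ℕ) = m + 1 ∨ (i : ℕ) = m + 2 := by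
  by_cases h0 : (i : ℕ) = 0
  · exact Or.inl h0
  by_cases hm : (i : ℕ) ≤ m
  · exact Or.inr (Or.inl ⟨m + 1 - i, by omega, by omega, by omega⟩)
  · omega

lemma center_zero (hi : (i : ℕ) = 0) : center m x₁ x₂ x₃ b i = x₁ := if_pos hi

lemma center_middle {l : ℕ} (hl : 1 ≤ l) (hlm : l ≤ m) (hi : (i : ℕ) + l = m + 1) :
    center m x₁ x₂ x₃ b i = b l := by
  unfold center
  rw [if_neg (by omega), if_pos (by omega)]
  congr 1
  omega

lemma center_penultimate (hi : (i : ℕ) = m + 1) : center m x₁ x₂ x₃ b i = x₂ := by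
  unfold center
  rw [if_neg (by omega), if_neg (by omega), if_pos hi]

lemma center_last (hi : (i : ℕ) = m + 2) : center m x₁ x₂ x₃ b i = x₃ := by
  unfold center
  rw [if_neg (by omega), if_neg (by omega), if_neg (by omega)]

end Index

namespace IsPottsBethe

variable {θ q x₁ x₂ x₃ : ℚ_[p]} {m : ℕ} {b : ℕ → ℚ_[p]}

lemma center_cases (h : IsPottsBethe θ q x₁ x₂ x₃ m) (hb : IsBackwardOrbit θ q x₁ b)
    (i : Fin (m + 3)) :
    ((i : ℕ) ≤ m ∧ ‖center m x₁ x₂ x₃ b i - pole θ q‖ = ‖θ - 1‖) ∨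
      (m < (i : ℕ) ∧ ‖center m x₁ x₂ x₃ b i - pole θ q‖ = ‖q‖ * ‖θ - 1‖ ∧
        ‖mob θ q (center m x₁ x₂ x₃ b i)‖ = 1 ∧
        pb θ q (center m x₁ x₂ x₃ b i) = center m x₁ x₂ x₃ b i) := by
  rcases index_cases i with hi | ⟨l, hl, hlm, hi⟩ | hi | hi
  · left
    rw [center_zero hi]
    exact ⟨by omega, h.dist_one⟩
  · left
    rw [center_middle hl hlm hi]
    exact ⟨by omega, h.dist_orbit_pole hb hl⟩
  · right
    rw [center_penultimate hi]
    exact ⟨by omega, h.dist_two, h.norm_mob_two, h.fix_two⟩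
  · right
    rw [center_last hi]
    exact ⟨by omega, h.dist_three, h.norm_mob_three, h.fix_three⟩

lemma norm_q_eq (h : IsPottsBethe θ q x₁ x₂ x₃ m) : (p : ℝ) ^ (-q.valuation) = ‖q‖ :=
  (Padic.norm_eq_zpow_neg_valuation (norm_pos_iff.1 h.q_pos)).symm

lemma norm_eps_eq (h : IsPottsBethe θ q x₁ x₂ x₃ m) :
    (p : ℝ) ^ (-(θ - 1).valuation) = ‖θ - 1‖ :=
  (Padic.norm_eq_zpow_neg_valuation (norm_pos_iff.1 h.eps_pos)).symm

lemma zpow_rad (h : IsPottsBethe θ q x₁ x₂ x₃ m) :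
    (p : ℝ) ^ (-(q.valuation + (θ - 1).valuation)) = ‖q‖ * ‖θ - 1‖ := by
  rw [neg_add, zpow_add₀ prime_cast_pos.ne', h.norm_q_eq, h.norm_eps_eq]

lemma zpow_exponent_of_le (h : IsPottsBethe θ q x₁ x₂ x₃ m) {i : Fin (m + 3)}
    (hi : (i : ℕ) ≤ m) : (p : ℝ) ^ exponent θ q m i = ‖q‖ / ‖θ - 1‖ := by
  unfold exponent
  rw [if_pos hi, ← h.norm_q_eq, ← h.norm_eps_eq, ← zpow_sub₀ prime_cast_pos.ne']
  congr 1
  ring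

lemma zpow_exponent_of_lt (h : IsPottsBethe θ q x₁ x₂ x₃ m) {i : Fin (m + 3)}
    (hi : m < (i : ℕ)) : (p : ℝ) ^ exponent θ q m i = (‖q‖ * ‖θ - 1‖)⁻¹ := by
  unfold exponent
  rw [if_neg (by omega), ← h.zpow_rad, ← zpow_neg, neg_neg, add_comm]

/-- The input to the scaling law on each ball: its ratio r/|a - x^(∞)|² is |q|/|θ-1| for centres on
the sphere and 1/r for x₂, x₃. -/
lemma center_facts (h : IsPottsBethe θ q x₁ x₂ x₃ m) (hb : IsBackwardOrbit θ q x₁ b)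
    (i : Fin (m + 3)) : ‖q‖ * ‖θ - 1‖ ≤ ‖center m x₁ x₂ x₃ b i - pole θ q‖ ∧
      ‖mob θ q (center m x₁ x₂ x₃ b i)‖ = 1 ∧
      ‖q‖ * ‖θ - 1‖ / ‖center m x₁ x₂ x₃ b i - pole θ q‖ ^ 2 = (p : ℝ) ^ exponent θ q m i := by
  have hq := h.q_pos
  have hε := h.eps_pos
  rcases h.center_cases hb i with ⟨hi, hd⟩ | ⟨hi, hd, hmob, -⟩
  · refine ⟨hd ▸ h.rad_lt_eps.le, h.norm_mob_of_far (hd ▸ h.rad_lt_eps), ?_⟩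
    rw [h.zpow_exponent_of_le hi, hd]
    field_simp
  · refine ⟨hd.ge, hmob, ?_⟩
    rw [h.zpow_exponent_of_lt hi, hd]
    field_simp

lemma one_lt_zpow_exponent (h : IsPottsBethe θ q x₁ x₂ x₃ m) (i : Fin (m + 3)) :
    1 < (p : ℝ) ^ exponent θ q m i := by
  rcases Nat.lt_or_ge m i with hi | hi
  · rw [h.zpow_exponent_of_lt hi]
    exact (one_lt_inv₀ h.rad_pos).2 (h.rad_lt_eps.trans h.eps_lt_one)
  · rw [h.zpow_exponent_of_le hi]
    exact h.expansion_gt_one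

lemma exponent_pos (h : IsPottsBethe θ q x₁ x₂ x₃ m) (i : Fin (m + 3)) :
    0 < exponent θ q m i :=
  (one_lt_zpow_iff_right₀ one_lt_prime_cast).1 (h.one_lt_zpow_exponent i)

lemma image_ball_center (h : IsPottsBethe θ q x₁ x₂ x₃ m) (hb : IsBackwardOrbit θ q x₁ b)
    (i : Fin (m + 3)) :
    pb θ q '' Metric.ball (center m x₁ x₂ x₃ b i) (‖q‖ * ‖θ - 1‖) =
      Metric.ball (pb θ q (center m x₁ x₂ x₃ b i))
        ((p : ℝ) ^ exponent θ q m i * (‖q‖ * ‖θ - 1‖)) := by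
  obtain ⟨h1, h2, h3⟩ := h.center_facts hb i
  rw [h.image_pb_ball h1 h2 h1, h3]

lemma rad_le_dist_center (h : IsPottsBethe θ q x₁ x₂ x₃ m) (hb : IsBackwardOrbit θ q x₁ b)
    {i j : Fin (m + 3)} (hij : (i : ℕ) < j) :
    ‖q‖ * ‖θ - 1‖ ≤ ‖center m x₁ x₂ x₃ b i - center m x₁ x₂ x₃ b j‖ := by
  have hr := h.rad_lt_eps.le
  rw [norm_sub_rev (center m x₁ x₂ x₃ b i)]
  rcases index_cases i with hi | ⟨l, hl, hlm, hi⟩ | hi | hi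
  · rw [center_zero hi]
    rcases index_cases j with hj | ⟨k, hk, hkm, hj⟩ | hj | hj
    · omega
    · rw [center_middle hk hkm hj, hb.dist]
      exact h.rad_le_level hkm
    · rwa [center_penultimate hj, h.dist_fix_small h.dist_two]
    · rwa [center_last hj, h.dist_fix_small h.dist_three]
  · rw [center_middle hl hlm hi]
    rcases index_cases j with hj | ⟨k, hk, hkm, hj⟩ | hj | hj
    · omega
    · rw [center_middle hk hkm hj, h.dist_orbit_orbit hb (by omega)]
      exact h.rad_le_level hkm
    · rwa [center_penultimate hj, h.dist_orbit_small hb hl h.dist_two]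
    · rwa [center_last hj, h.dist_orbit_small hb hl h.dist_three]
  · rw [center_penultimate hi, center_last (by omega), norm_sub_rev x₃ x₂, h.separated]
  · omega

theorem isCoding (h : IsPottsBethe θ q x₁ x₂ x₃ m) (hb : IsBackwardOrbit θ q x₁ b) :
    IsCoding θ q x₁ x₂ x₃ m (center m x₁ x₂ x₃ b) (q.valuation + (θ - 1).valuation) where
  radius := h.zpow_rad
  first i hi := by rw [center_zero hi]
  middle i l hi hl hil := by
    rw [center_middle hl (by omega) hil, h.setH_eq_ball hb hl (by omega), rad]
  penultimate i hi := by rw [center_penultimate hi, setC_eq_ball h.dist_two, rad]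
  last i hi := by rw [center_last hi, setC_eq_ball h.dist_three, rad]

theorem isRepeller (h : IsPottsBethe θ q x₁ x₂ x₃ m) (hb : IsBackwardOrbit θ q x₁ b) :
    IsRepeller (dom θ q) (pb θ q) (setX θ q x₁ x₂ x₃ m) (center m x₁ x₂ x₃ b)
      (q.valuation + (θ - 1).valuation) (exponent θ q m) where
  subset_dom := h.setX_subset_dom hb
  preimage_subset := fun x hx => h.mem_setX_of_pb_mem hb (hx.1 0 one_pos) hx.2
  eq_iUnion := by
    ext x
    rw [h.mem_setX_iff hb, Set.mem_iUnion, h.zpow_rad]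
    simp only [Metric.mem_ball, dist_eq_norm]
    constructor
    · rintro (hx | ⟨l, hl, hlm, hx⟩ | hx | hx)
      · exact ⟨⟨0, by omega⟩, by rwa [center_zero rfl]⟩
      · exact ⟨⟨m + 1 - l, by omega⟩, by rwa [center_middle hl hlm (by simp; omega)]⟩
      · exact ⟨⟨m + 1, by omega⟩, by rwa [center_penultimate rfl]⟩
      · exact ⟨⟨m + 2, by omega⟩, by rwa [center_last rfl]⟩
    · rintro ⟨i, hx⟩
      rcases index_cases i with hi | ⟨l, hl, hlm, hi⟩ | hi | hi
      · rw [center_zero hi] at hx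
        exact Or.inl hx
      · rw [center_middle hl hlm hi] at hx
        exact Or.inr (Or.inl ⟨l, hl, hlm, hx⟩)
      · rw [center_penultimate hi] at hx
        exact Or.inr (Or.inr (Or.inl hx))
      · rw [center_last hi] at hx
        exact Or.inr (Or.inr (Or.inr hx))
  disjoint := by
    intro i j hij
    rw [h.zpow_rad, Set.disjoint_left]
    intro z hzi hzj
    rw [Metric.mem_ball, dist_eq_norm] at hzi hzj
    have hlt : ‖center m x₁ x₂ x₃ b i - center m x₁ x₂ x₃ b j‖ < ‖q‖ * ‖θ - 1‖ :=
      norm_sub_lt_of_lt (by rwa [norm_sub_rev]) hzj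
    rcases lt_or_gt_of_ne (Fin.val_ne_of_ne hij) with hlt' | hgt'
    · exact absurd hlt (not_lt.2 (h.rad_le_dist_center hb hlt'))
    · rw [norm_sub_rev] at hlt
      exact absurd hlt (not_lt.2 (h.rad_le_dist_center hb hgt'))
  scaling := by
    intro i x hx y hy
    obtain ⟨h1, h2, h3⟩ := h.center_facts hb i
    rw [h.zpow_rad, Metric.mem_ball, dist_eq_norm] at hx hy
    rw [h.norm_pb_sub_of_mem_ball h1 h2 (hx.trans_le h1) (hy.trans_le h1), h3]
  pos := h.exponent_pos

/-- The image ball is larger than the target ball, so meeting it amounts to containing its centre.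
-/
lemma incidence_center_eq_one_iff (h : IsPottsBethe θ q x₁ x₂ x₃ m)
    (hb : IsBackwardOrbit θ q x₁ b) (i j : Fin (m + 3)) :
    incidence (pb θ q) (center m x₁ x₂ x₃ b) (q.valuation + (θ - 1).valuation) i j = 1 ↔
      ‖center m x₁ x₂ x₃ b j - pb θ q (center m x₁ x₂ x₃ b i)‖ <
        (p : ℝ) ^ exponent θ q m i * (‖q‖ * ‖θ - 1‖) := by
  rw [incidence_eq_one_iff, h.zpow_rad, h.image_ball_center hb]
  constructor
  · rintro ⟨z, hz1, hz2⟩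
    rw [Metric.mem_ball, dist_eq_norm] at hz1 hz2
    refine norm_sub_lt_of_lt (y := z) ?_ hz2
    rw [norm_sub_rev]
    exact hz1.trans (lt_mul_of_one_lt_left h.rad_pos (h.one_lt_zpow_exponent i))
  · intro hlt
    exact ⟨_, Metric.mem_ball_self h.rad_pos, by rwa [Metric.mem_ball, dist_eq_norm]⟩

/-- The right side is |q|², the radius of the images of 𝒟₁ and of the ℋ_l. Undoing one expansion
compares level l+1 with r, and the threshold there is m+1. -/
lemma level_lt_expansion_iff (h : IsPottsBethe θ q x₁ x₂ x₃ m) (l : ℕ) :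
    ‖θ - 1‖ * (‖θ - 1‖ / ‖q‖) ^ l < ‖q‖ / ‖θ - 1‖ * (‖q‖ * ‖θ - 1‖) ↔ m ≤ l := by
  rw [← h.expansion_mul_level, mul_lt_mul_iff_right₀ (one_pos.trans h.expansion_gt_one)]
  constructor
  · intro hlt
    by_contra! hl
    exact absurd hlt (not_lt.2 (h.rad_le_level hl))
  · intro hl
    rcases hl.eq_or_lt with rfl | hl
    · exact h.level_lt_rad
    · exact (h.level_lt_level (by omega)).trans h.level_lt_rad

lemma not_eps_lt_expansion (h : IsPottsBethe θ q x₁ x₂ x₃ m) :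
    ¬ ‖θ - 1‖ < ‖q‖ / ‖θ - 1‖ * (‖q‖ * ‖θ - 1‖) := by
  have := h.level_lt_expansion_iff 0
  rw [pow_zero, mul_one] at this
  rw [this]
  have := h.one_le
  omega

/-- Of the other centres, only b_m is within |q|² of x₁. The image of ℋ_l is centred at b_(l-1) and
contains no other centre, except that for l = 1 it is centred at the pole and contains just x₂ and
x₃. The images of 𝒞₂ and 𝒞₃ have radius 1 and contain everything. -/
lemma incidence_center_iff_matA (h : IsPottsBethe θ q x₁ x₂ x₃ m)
    (hb : IsBackwardOrbit θ q x₁ b) (i j : Fin (m + 3)) :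
    incidence (pb θ q) (center m x₁ x₂ x₃ b) (q.valuation + (θ - 1).valuation) i j = 1 ↔
      matA m i j = 1 := by
  have hm := h.one_le
  have hexp : 0 < ‖q‖ / ‖θ - 1‖ * (‖q‖ * ‖θ - 1‖) :=
    mul_pos (one_pos.trans h.expansion_gt_one) h.rad_pos
  have hne := h.not_eps_lt_expansion
  rw [h.incidence_center_eq_one_iff hb, matA_eq_one_iff]
  rcases index_cases i with hi | ⟨l, hl, hlm, hi⟩ | hi
  · rw [h.zpow_exponent_of_le (by omega), center_zero hi, h.fix_one]
    rcases index_cases j with hj | ⟨k, hk, hkm, hj⟩ | hj | hj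
    · rw [center_zero hj, sub_self, norm_zero]
      exact iff_of_true hexp (by omega)
    · rw [center_middle hk hkm hj, hb.dist, h.level_lt_expansion_iff]
      omega
    · rw [center_penultimate hj, h.dist_fix_small h.dist_two]
      exact iff_of_false hne (by omega)
    · rw [center_last hj, h.dist_fix_small h.dist_three]
      exact iff_of_false hne (by omega)
  · obtain ⟨l, rfl⟩ := Nat.exists_eq_add_of_le' hl
    rw [h.zpow_exponent_of_le (by omega), center_middle hl hlm hi, hb.map]
    have hsmall : ∀ x : ℚ_[p], ‖x - pole θ q‖ = ‖q‖ * ‖θ - 1‖ →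
        (‖x - b l‖ < ‖q‖ / ‖θ - 1‖ * (‖q‖ * ‖θ - 1‖) ↔ l = 0) := by
      intro x hx
      rcases Nat.eq_zero_or_pos l with h0 | h0
      · rw [h0, hb.zero, hx]
        exact iff_of_true (lt_mul_of_one_lt_left h.rad_pos h.expansion_gt_one) rfl
      · rw [h.dist_orbit_small hb h0 hx]
        exact iff_of_false hne h0.ne'
    rcases index_cases j with hj | ⟨k, hk, hkm, hj⟩ | hj | hj
    · rw [center_zero hj, norm_sub_rev, hb.dist, h.level_lt_expansion_iff]
      omega
    · rw [center_middle hk hkm hj]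
      rcases lt_trichotomy k l with hkl | hkl | hkl
      · rw [h.dist_orbit_orbit hb hkl, h.level_lt_expansion_iff]
        omega
      · rw [hkl, sub_self, norm_zero]
        exact iff_of_true hexp (by omega)
      · rw [norm_sub_rev, h.dist_orbit_orbit hb hkl, h.level_lt_expansion_iff]
        omega
    · rw [center_penultimate hj, hsmall _ h.dist_two]
      omega
    · rw [center_last hj, hsmall _ h.dist_three]
      omega
  · have hmi : m < (i : ℕ) := by omega
    refine iff_of_true ?_ (by omega)
    rcases h.center_cases hb i with ⟨hi', -⟩ | ⟨-, hd, -, hfix⟩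
    · omega
    rw [h.zpow_exponent_of_lt hmi, inv_mul_cancel₀ h.rad_pos.ne', hfix]
    refine (norm_sub_le_of_le (y := pole θ q) ?_ ?_).trans_lt h.eps_lt_one
    · rcases h.center_cases hb j with ⟨-, hj⟩ | ⟨-, hj, -⟩
      · exact hj.le
      · exact hj.trans_le h.rad_lt_eps.le
    · rw [norm_sub_rev, hd]
      exact h.rad_lt_eps.le

theorem incidence_center_eq (h : IsPottsBethe θ q x₁ x₂ x₃ m) (hb : IsBackwardOrbit θ q x₁ b) :
    incidence (pb θ q) (center m x₁ x₂ x₃ b) (q.valuation + (θ - 1).valuation) = matA m := by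
  ext i j
  have key := h.incidence_center_iff_matA hb i j
  by_cases h1 : matA m i j = 1
  · rw [h1, key.2 h1]
  · have h2 := mt key.1 h1
    rw [(matA_eq_zero_or_one m i j).resolve_right h1]
    unfold incidence at h2 ⊢
    split_ifs at h2 ⊢ with h3
    · exact absurd rfl h2
    · rfl

theorem isometricConj (h : IsPottsBethe θ q x₁ x₂ x₃ m) (hb : IsBackwardOrbit θ q x₁ b) :
    IsometricConj (pb θ q) (juliaSet (dom θ q) (pb θ q) (setX θ q x₁ x₂ x₃ m)) (matA m)
      (center m x₁ x₂ x₃ b) (exponent θ q m) := by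
  rw [← h.incidence_center_eq hb]
  refine (h.isRepeller hb).isometricConj fun i => ?_
  rw [h.zpow_rad]
  exact h.image_ball_center hb i

end IsPottsBethe

lemma pow_le_pow_of_rpow_div_le {x y : ℝ} (hx : 0 ≤ x) {k n : ℕ} (hn : n ≠ 0)
    (h : x ^ ((k : ℝ) / n) ≤ y) : x ^ k ≤ y ^ n := by
  have := pow_le_pow_left₀ (Real.rpow_nonneg hx _) h n
  rwa [← Real.rpow_mul_natCast hx, div_mul_cancel₀ _ (by exact_mod_cast hn),
    Real.rpow_natCast] at this

lemma pow_lt_pow_of_lt_rpow_div {x y : ℝ} (hx : 0 ≤ x) (hy : 0 ≤ y) {k n : ℕ} (hn : n ≠ 0)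
    (h : y < x ^ ((k : ℝ) / n)) : y ^ n < x ^ k := by
  have := pow_lt_pow_left₀ h hy hn
  rwa [← Real.rpow_mul_natCast hx, div_mul_cancel₀ _ (by exact_mod_cast hn),
    Real.rpow_natCast] at this

end PottsBethe

theorem theorem5p7 (p : ℕ) [Fact p.Prime] (hp : p ≡ 1 [MOD 3]) (θ q : ℚ_[p]) (m : ℕ) (hm : 1 ≤ m)
    (hq0 : 0 < ‖q‖) (hq1 : ‖q‖ < 1)
    (h1 : ‖q‖ ^ (((m : ℝ) + 1) / (m : ℝ)) ≤ ‖θ - 1‖)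
    (h2 : ‖θ - 1‖ < ‖q‖ ^ (((m : ℝ) + 2) / ((m : ℝ) + 1))) :
    (∃ y₁ y₂ y₃ : ℚ_[p], IsRootTriple θ q y₁ y₂ y₃) ∧
    ∀ y₁ y₂ y₃ x₁ x₂ x₃ : ℚ_[p], ∀ X J : Set ℚ_[p], IsRootTriple θ q y₁ y₂ y₃ →
      x₁ = fixPt θ q y₁ → x₂ = fixPt θ q y₂ → x₃ = fixPt θ q y₃ →
      X = setX θ q x₁ x₂ x₃ m →
      J = juliaSet (dom θ q) (pb θ q) X →
      (∃ (a : Fin (m + 3) → ℚ_[p]) (t : ℤ) (τ : Fin (m + 3) → ℤ),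
        IsCoding θ q x₁ x₂ x₃ m a t ∧
        IsRepeller (dom θ q) (pb θ q) X a t τ ∧
        incidence (pb θ q) a t = matA m ∧
        (incidence (pb θ q) a t).IsIrreducible ∧
        IsometricConj (pb θ q) J (matA m) a τ) ∧
      TopConj (matA m) (fullMatrix 3) ∧
      (Set.univ : Set ℚ_[p]) =
        basin (dom θ q) (pb θ q) 1 ∪ J ∪
          ⋃ n : ℕ, preimageIter (dom θ q) (pb θ q) n {pole θ q} := by
  have hε : 0 < ‖θ - 1‖ := (Real.rpow_pos_of_pos hq0 _).trans_le h1
  -- Clearing the denominators m and m+1 of the real exponents leaves integer powers, the form in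
  -- which the bounds are used.
  have hlow : ‖q‖ ^ (m + 1) ≤ ‖θ - 1‖ ^ m :=
    pow_le_pow_of_rpow_div_le hq0.le (by omega) (by push_cast; exact h1)
  have hup : ‖θ - 1‖ ^ (m + 1) < ‖q‖ ^ (m + 2) :=
    pow_lt_pow_of_lt_rpow_div hq0.le hε.le (by omega) (by push_cast; exact h2)
  have hε1 : ‖θ - 1‖ < 1 := by
    refine h2.trans (Real.rpow_lt_one hq0.le hq1 ?_)
    positivity
  refine ⟨exists_isRootTriple hp hε1 hq1, ?_⟩
  rintro y₁ y₂ y₃ _ _ _ _ _ hy rfl rfl rfl rfl rfl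
  have h := hy.isPottsBethe hp hm hq0 hq1 hε hlow hup
  obtain ⟨b, hb⟩ := h.exists_isBackwardOrbit
  refine ⟨⟨_, _, _, h.isCoding hb, h.isRepeller hb, h.incidence_center_eq hb, ?_,
    h.isometricConj hb⟩, topConj_matA_fullMatrix m hm, h.univ_eq hb⟩
  rw [h.incidence_center_eq hb]
  exact matA_isIrreducible m
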